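/- Let $G$ be a (discrete) group and let $\omega : G \to (0,\infty)$ be a weight, i.e. $\omega(xy) \le \omega(x)\omega(y)$ for all $x, y \in G$. Let $\ell^1(G,\omega)$ be the Banach algebra of all functions $f : G \to \mathbb{C}$ with $\|f\| = \sum_{x \in G} |f(x)|\,\omega(x) < \infty$, with convolution $(f*g)(x) = \sum_{y\in G} f(y)\,g(y^{-1}x)$ as multiplication. Then $\ell^1(G,\omega)$ is an injective algebra if and only if it is isomorphic to an operator algebra. Here a complex Banach algebra $A$ is called an injective algebra if its multiplication $a \otimes b \mapsto ab$ extends to a bounded linear map $A \otimes_\varepsilon A \to A$, where $A \otimes_\varepsilon A$ is the injective tensor product, i.e. the completion of the algebraic tensor product $A \otimes A$ for the norm $\|t\|_\varepsilon = \sup\{ |(\varphi\otimes\psi)(t)| : \varphi, \psi \in A^*, \|\varphi\|, \|\psi\| \le 1 \}$. An operator algebra is a norm-closed (not necessarily self-adjoint or unital) subalgebra $B$ of the algebra $B(H)$ of bounded operators on a complex Hilbert space $H$, and $A$ is isomorphic to $B$ if there is an algebra isomorphism $A \to B$ that is bounded and has a bounded inverse. -/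

import Mathlib

open scoped TensorProduct

universe u v w

noncomputable section

/-! ### The injective tensor product of two complex normed spaces -/

section InjectiveTensor

variable (E : Type u) (F : Type v)
  [SeminormedAddCommGroup E] [NormedSpace ℂ E] [SeminormedAddCommGroup F] [NormedSpace ℂ F]

variable {E F} in
/-- The functional `φ ⊗ ψ` on the algebraic tensor product: `a ⊗ b ↦ φ a * ψ b`. -/
def dualTensor (φ : StrongDual ℂ E) (ψ : StrongDual ℂ F) : E ⊗[ℂ] F →ₗ[ℂ] ℂ :=
  LinearMap.mul' ℂ ℂ ∘ₗ TensorProduct.map (φ : E →ₗ[ℂ] ℂ) (ψ : F →ₗ[ℂ] ℂ)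

/-- Pairs of functionals of norm at most one. -/
abbrev DualBalls : Type (max u v) :=
  Metric.closedBall (0 : StrongDual ℂ E) 1 × Metric.closedBall (0 : StrongDual ℂ F) 1

variable {E F} in
/-- The injective norm `ε(t) = sup {|(φ ⊗ ψ)(t)| : ‖φ‖ ≤ 1, ‖ψ‖ ≤ 1}`. -/
def injectiveTensorNorm (t : E ⊗[ℂ] F) : ℝ :=
  ⨆ p : DualBalls E F, ‖dualTensor (p.1 : StrongDual ℂ E) (p.2 : StrongDual ℂ F) t‖

instance DualBalls.instNonempty : Nonempty (DualBalls E F) :=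
  ⟨⟨⟨0, by simp⟩, ⟨0, by simp⟩⟩⟩

variable {E F} in
theorem bddAbove_injectiveTensorNorm (t : E ⊗[ℂ] F) :
    BddAbove (Set.range fun p : DualBalls E F =>
      ‖dualTensor (p.1 : StrongDual ℂ E) (p.2 : StrongDual ℂ F) t‖) := by
  induction t using TensorProduct.induction_on with
  | zero => exact ⟨0, by rintro _ ⟨p, rfl⟩; simp⟩
  | tmul a b =>
    refine ⟨‖a‖ * ‖b‖, ?_⟩
    rintro _ ⟨⟨⟨φ, hφ⟩, ⟨ψ, hψ⟩⟩, rfl⟩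
    rw [mem_closedBall_zero_iff] at hφ hψ
    simp only [dualTensor, LinearMap.comp_apply, TensorProduct.map_tmul, LinearMap.mul'_apply,
      ContinuousLinearMap.coe_coe, norm_mul]
    exact mul_le_mul ((φ.le_of_opNorm_le hφ a).trans_eq (one_mul _))
      ((ψ.le_of_opNorm_le hψ b).trans_eq (one_mul _)) (norm_nonneg _) (norm_nonneg _)
  | add s t hs ht =>
    obtain ⟨M, hM⟩ := hs
    obtain ⟨N, hN⟩ := ht
    refine ⟨M + N, ?_⟩
    rintro _ ⟨p, rfl⟩
    simp only [map_add]
    exact (norm_add_le _ _).trans (add_le_add (hM ⟨p, rfl⟩) (hN ⟨p, rfl⟩))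

/-- The injective norm, bundled as a seminorm on the algebraic tensor product. -/
def injectiveTensorSeminorm : Seminorm ℂ (E ⊗[ℂ] F) :=
  Seminorm.ofSMulLE injectiveTensorNorm
    (by simp [injectiveTensorNorm])
    (fun s t => ciSup_le fun p => by
      rw [map_add]
      exact (norm_add_le _ _).trans (add_le_add
        (le_ciSup (bddAbove_injectiveTensorNorm s) p)
        (le_ciSup (bddAbove_injectiveTensorNorm t) p)))
    (fun c t => ciSup_le fun p => by
      rw [map_smul, norm_smul]
      exact mul_le_mul_of_nonneg_left (le_ciSup (bddAbove_injectiveTensorNorm t) p)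
        (norm_nonneg c))

/-- A copy of the algebraic tensor product `E ⊗ F`, to be equipped with the injective norm. -/
def AlgInjectiveTensor : Type (max u v) := E ⊗[ℂ] F

instance AlgInjectiveTensor.instAddCommGroup : AddCommGroup (AlgInjectiveTensor E F) :=
  inferInstanceAs (AddCommGroup (E ⊗[ℂ] F))

instance AlgInjectiveTensor.instModule : Module ℂ (AlgInjectiveTensor E F) :=
  inferInstanceAs (Module ℂ (E ⊗[ℂ] F))

instance AlgInjectiveTensor.instSeminormedAddCommGroup :
    SeminormedAddCommGroup (AlgInjectiveTensor E F) :=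
  AddGroupSeminorm.toSeminormedAddCommGroup (injectiveTensorSeminorm E F).toAddGroupSeminorm

instance AlgInjectiveTensor.instNormedSpace : NormedSpace ℂ (AlgInjectiveTensor E F) where
  norm_smul_le c t := ((injectiveTensorSeminorm E F).smul' c t).le

theorem AlgInjectiveTensor.norm_def (t : E ⊗[ℂ] F) :
    ‖(show AlgInjectiveTensor E F from t)‖ = injectiveTensorNorm t := rfl

/-- The injective tensor product `E ⊗_ε F`: the completion of `E ⊗ F` for the injective norm. -/
abbrev InjectiveTensor : Type (max u v) := UniformSpace.Completion (AlgInjectiveTensor E F)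

variable {E F} in
/-- The elementary tensor `a ⊗ b` as an element of `E ⊗_ε F`. -/
def InjectiveTensor.tmul (a : E) (b : F) : InjectiveTensor E F :=
  ((show AlgInjectiveTensor E F from a ⊗ₜ[ℂ] b : AlgInjectiveTensor E F) : InjectiveTensor E F)

end InjectiveTensor

/-! ### Injective Banach algebras and operator algebras -/

section BanachAlgebras

variable (A : Type u) [NonUnitalNormedRing A] [NormedSpace ℂ A]

/-- `A` is an injective algebra: its multiplication `a ⊗ b ↦ a * b` extends to a bounded linear
map `A ⊗_ε A → A`. -/
def IsInjectiveAlgebra : Prop :=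
  ∃ m : InjectiveTensor A A →L[ℂ] A, ∀ a b : A, m (InjectiveTensor.tmul a b) = a * b

/-- `A` is isomorphic to an operator algebra: there are a complex Hilbert space `H`, a norm-closed
(not necessarily unital, not necessarily self-adjoint) subalgebra `B` of `B(H)`, and an algebra
isomorphism `A ≃ B` that is bounded together with its inverse. -/
def IsIsomorphicToOperatorAlgebra : Prop :=
  ∃ (H : Type w) (_ : NormedAddCommGroup H) (_ : InnerProductSpace ℂ H) (_ : CompleteSpace H)
    (B : NonUnitalSubalgebra ℂ (H →L[ℂ] H)) (ψ : A ≃L[ℂ] B),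
    IsClosed (B : Set (H →L[ℂ] H)) ∧ ∀ a b : A, ψ (a * b) = ψ a * ψ b

end BanachAlgebras

/-! ### Weighted group algebras -/

/-- A weight on a group: a submultiplicative function with values in `(0, ∞)`. -/
structure GroupWeight (G : Type u) [Group G] where
  toFun : G → ℝ
  pos : ∀ x, 0 < toFun x
  submul : ∀ x y, toFun (x * y) ≤ toFun x * toFun y

section WeightedL1

variable {G : Type u} [Group G]

instance GroupWeight.instCoeFun : CoeFun (GroupWeight G) fun _ => G → ℝ := ⟨GroupWeight.toFun⟩

/-- The functions `f : G → ℂ` with `∑ |f x| ω x < ∞`. -/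
def weightedL1Submodule (ω : GroupWeight G) : Submodule ℂ (G → ℂ) where
  carrier := {f | Summable fun x => ‖f x‖ * ω x}
  zero_mem' := by simp [summable_zero]
  add_mem' := by
    intro f g hf hg
    refine Summable.of_nonneg_of_le (fun x => mul_nonneg (norm_nonneg _) (ω.pos x).le)
      (fun x => ?_) (hf.add hg)
    rw [← add_mul]
    exact mul_le_mul_of_nonneg_right (norm_add_le _ _) (ω.pos x).le
  smul_mem' := by
    intro c f hf
    refine (hf.mul_left ‖c‖).congr fun x => ?_
    simp [mul_assoc]

/-- The weighted group algebra `ℓ¹(G, ω)`. -/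
def WeightedL1 (ω : GroupWeight G) : Type u := weightedL1Submodule ω

namespace WeightedL1

variable {ω : GroupWeight G}

instance instAddCommGroup : AddCommGroup (WeightedL1 ω) :=
  inferInstanceAs (AddCommGroup (weightedL1Submodule ω))

instance instModule : Module ℂ (WeightedL1 ω) :=
  inferInstanceAs (Module ℂ (weightedL1Submodule ω))

instance instCoeFun : CoeFun (WeightedL1 ω) fun _ => G → ℂ := ⟨Subtype.val⟩

theorem summable (f : WeightedL1 ω) : Summable fun x => ‖f x‖ * ω x := f.2

@[ext] theorem ext {f g : WeightedL1 ω} (h : ∀ x, f x = g x) : f = g := Subtype.ext (funext h)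

@[simp] theorem zero_apply (x : G) : (0 : WeightedL1 ω) x = 0 := rfl
@[simp] theorem add_apply (f g : WeightedL1 ω) (x : G) : (f + g) x = f x + g x := rfl
@[simp] theorem smul_apply (c : ℂ) (f : WeightedL1 ω) (x : G) : (c • f) x = c * f x := rfl

theorem term_nonneg (f : WeightedL1 ω) (x : G) : 0 ≤ ‖f x‖ * ω x :=
  mul_nonneg (norm_nonneg _) (ω.pos x).le

/-- The norm `‖f‖ = ∑ |f x| ω x`. -/
instance instNorm : Norm (WeightedL1 ω) := ⟨fun f => ∑' x, ‖f x‖ * ω x⟩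

theorem norm_def (f : WeightedL1 ω) : ‖f‖ = ∑' x, ‖f x‖ * ω x := rfl

theorem term_le_norm (f : WeightedL1 ω) (x : G) : ‖f x‖ * ω x ≤ ‖f‖ :=
  f.summable.le_tsum x fun y _ => f.term_nonneg y

/-- The underlying linear isometry `f ↦ f ω` onto `ℓ¹(G)`. -/
def toL1 (ω : GroupWeight G) : WeightedL1 ω ≃ₗ[ℂ] lp (fun _ : G => ℂ) 1 where
  toFun f := ⟨fun x => f x * ω x, memℓp_gen (by
    simpa [abs_of_pos (ω.pos _)] using f.summable)⟩
  map_add' f g := by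
    ext x
    exact add_mul (f x) (g x) (ω x : ℂ)
  map_smul' c f := by ext x; simp [mul_assoc]
  invFun g := ⟨fun x => g x / ω x, by
    have h : Summable fun x => ‖g x‖ := by simpa using (lp.memℓp g).summable (by simp)
    refine h.congr fun x => ?_
    simp [abs_of_pos (ω.pos x), (ω.pos x).ne']⟩
  left_inv f := by
    refine WeightedL1.ext fun x => ?_
    exact mul_div_cancel_right₀ _ (by exact_mod_cast (ω.pos x).ne')
  right_inv g := by
    ext x
    exact div_mul_cancel₀ _ (by exact_mod_cast (ω.pos x).ne')

theorem toL1_apply (f : WeightedL1 ω) (x : G) : toL1 ω f x = f x * ω x := rfl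

theorem norm_toL1 (f : WeightedL1 ω) : ‖toL1 ω f‖ = ‖f‖ := by
  rw [lp.norm_eq_tsum_rpow (by simp), norm_def]
  simp [toL1_apply, abs_of_pos (ω.pos _)]

instance instNormedAddCommGroup : NormedAddCommGroup (WeightedL1 ω) :=
  { NormedAddCommGroup.induced (WeightedL1 ω) (lp (fun _ : G => ℂ) 1) (toL1 ω)
      (toL1 ω).injective with
    norm := fun f => ‖f‖
    dist_eq := fun f g => by
      change ‖-toL1 ω f + toL1 ω g‖ = _
      rw [← norm_toL1, map_add, map_neg] }

instance instNormedSpace : NormedSpace ℂ (WeightedL1 ω) where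
  norm_smul_le c f := by rw [← norm_toL1, map_smul, norm_smul, norm_toL1]

instance instCompleteSpace : CompleteSpace (WeightedL1 ω) := by
  have h : Isometry (toL1 ω) := AddMonoidHomClass.isometry_of_norm _ norm_toL1
  exact (completeSpace_congr (e := (toL1 ω).toEquiv) h.isUniformEmbedding).2 inferInstance

theorem weight_le (x y : G) : ω x ≤ ω y * ω (y⁻¹ * x) := by
  simpa using ω.submul y (y⁻¹ * x)

theorem conv_term_le (f g : WeightedL1 ω) (x y : G) :
    ‖f y * g (y⁻¹ * x)‖ * ω x ≤ (‖f y‖ * ω y) * (‖g (y⁻¹ * x)‖ * ω (y⁻¹ * x)) := by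
  rw [norm_mul]
  calc _ ≤ ‖f y‖ * ‖g (y⁻¹ * x)‖ * (ω y * ω (y⁻¹ * x)) :=
        mul_le_mul_of_nonneg_left (weight_le x y) (by positivity)
    _ = _ := by ring

theorem summable_prod (f g : WeightedL1 ω) :
    Summable fun p : G × G => (‖f p.1‖ * ω p.1) * (‖g p.2‖ * ω p.2) :=
  f.summable.mul_of_nonneg g.summable f.term_nonneg g.term_nonneg

/-- The change of variables `(x, y) ↦ (y, y⁻¹ x)`. -/
def shear (G : Type u) [Group G] : G × G ≃ G × G where
  toFun p := (p.2, p.2⁻¹ * p.1)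
  invFun p := (p.1 * p.2, p.1)
  left_inv p := by simp
  right_inv p := by simp

theorem summable_shear (f g : WeightedL1 ω) :
    Summable fun p : G × G =>
      (‖f p.2‖ * ω p.2) * (‖g (p.2⁻¹ * p.1)‖ * ω (p.2⁻¹ * p.1)) :=
  (shear G).summable_iff.2 (summable_prod f g)

theorem summable_conv_weight (f g : WeightedL1 ω) (x : G) :
    Summable fun y => (‖f y‖ * ω y) * (‖g (y⁻¹ * x)‖ * ω (y⁻¹ * x)) :=
  (summable_shear f g).prod_factor x

theorem summable_norm_conv (f g : WeightedL1 ω) (x : G) :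
    Summable fun y => ‖f y * g (y⁻¹ * x)‖ := by
  have h : Summable fun y => ‖f y * g (y⁻¹ * x)‖ * ω x :=
    Summable.of_nonneg_of_le (fun y => mul_nonneg (norm_nonneg _) (ω.pos x).le)
      (fun y => conv_term_le f g x y) (summable_conv_weight f g x)
  exact (summable_mul_right_iff (ω.pos x).ne').1 h

theorem summable_conv (f g : WeightedL1 ω) (x : G) :
    Summable fun y => f y * g (y⁻¹ * x) :=
  (summable_norm_conv f g x).of_norm

theorem norm_conv_le (f g : WeightedL1 ω) (x : G) :
    ‖∑' y, f y * g (y⁻¹ * x)‖ * ω x ≤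
      ∑' y, (‖f y‖ * ω y) * (‖g (y⁻¹ * x)‖ * ω (y⁻¹ * x)) := by
  calc _ ≤ (∑' y, ‖f y * g (y⁻¹ * x)‖) * ω x :=
        mul_le_mul_of_nonneg_right (norm_tsum_le_tsum_norm (summable_norm_conv f g x))
          (ω.pos x).le
    _ = ∑' y, ‖f y * g (y⁻¹ * x)‖ * ω x := tsum_mul_right.symm
    _ ≤ _ := ((summable_norm_conv f g x).mul_right _).tsum_le_tsum
        (fun y => conv_term_le f g x y) (summable_conv_weight f g x)

/-- Multiplication in `ℓ¹(G, ω)` is convolution: `(f * g)(x) = ∑_y f(y) g(y⁻¹ x)`. -/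
instance instMul : Mul (WeightedL1 ω) where
  mul f g := ⟨fun x => ∑' y, f y * g (y⁻¹ * x),
    Summable.of_nonneg_of_le (fun x => mul_nonneg (norm_nonneg _) (ω.pos x).le)
      (norm_conv_le f g) (summable_shear f g).prod⟩

theorem mul_apply (f g : WeightedL1 ω) (x : G) : (f * g) x = ∑' y, f y * g (y⁻¹ * x) := rfl

theorem norm_mul_le' (f g : WeightedL1 ω) : ‖f * g‖ ≤ ‖f‖ * ‖g‖ := by
  calc ‖f * g‖ ≤ ∑' x, ∑' y, (‖f y‖ * ω y) * (‖g (y⁻¹ * x)‖ * ω (y⁻¹ * x)) :=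
        (f * g).summable.tsum_le_tsum (norm_conv_le f g) (summable_shear f g).prod
    _ = ∑' p : G × G, (‖f p.2‖ * ω p.2) * (‖g (p.2⁻¹ * p.1)‖ * ω (p.2⁻¹ * p.1)) :=
        ((summable_shear f g).tsum_prod).symm
    _ = ∑' p : G × G, (‖f p.1‖ * ω p.1) * (‖g p.2‖ * ω p.2) :=
        (shear G).tsum_eq fun p : G × G => (‖f p.1‖ * ω p.1) * (‖g p.2‖ * ω p.2)
    _ = ‖f‖ * ‖g‖ := (f.summable.tsum_mul_tsum g.summable (summable_prod f g)).symm

theorem summable_triple (f g h : WeightedL1 ω) (x : G) :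
    Summable fun p : G × G => f p.1 * (g p.2 * h (p.2⁻¹ * (p.1⁻¹ * x))) := by
  refine Summable.of_norm ((summable_mul_right_iff (ω.pos x).ne').1 ?_)
  refine Summable.of_nonneg_of_le (fun p => mul_nonneg (norm_nonneg _) (ω.pos x).le)
    (fun p => ?_) ((summable_prod f g).mul_right ‖h‖)
  have h1 : ω x ≤ ω p.1 * (ω p.2 * ω (p.2⁻¹ * (p.1⁻¹ * x))) :=
    (weight_le x p.1).trans (mul_le_mul_of_nonneg_left (weight_le _ p.2) (ω.pos _).le)
  have h2 := h.term_le_norm (p.2⁻¹ * (p.1⁻¹ * x))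
  have h3 := mul_nonneg (f.term_nonneg p.1) (g.term_nonneg p.2)
  calc _ ≤ ‖f p.1 * (g p.2 * h (p.2⁻¹ * (p.1⁻¹ * x)))‖ *
          (ω p.1 * (ω p.2 * ω (p.2⁻¹ * (p.1⁻¹ * x)))) :=
        mul_le_mul_of_nonneg_left h1 (norm_nonneg _)
    _ = ((‖f p.1‖ * ω p.1) * (‖g p.2‖ * ω p.2)) *
          (‖h (p.2⁻¹ * (p.1⁻¹ * x))‖ * ω (p.2⁻¹ * (p.1⁻¹ * x))) := by
        rw [norm_mul, norm_mul]; ring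
    _ ≤ _ := mul_le_mul_of_nonneg_left h2 h3

theorem mul_assoc' (f g h : WeightedL1 ω) : f * g * h = f * (g * h) := by
  ext x
  have key := summable_triple f g h x
  have key' : Summable fun p : G × G =>
      f p.2 * (g (p.2⁻¹ * p.1) * h (p.1⁻¹ * x)) := by
    refine ((shear G).summable_iff.2 key).congr fun p => ?_
    simp [shear, mul_assoc]
  calc (f * g * h) x = ∑' y, ∑' z, f z * (g (z⁻¹ * y) * h (y⁻¹ * x)) := by
        rw [mul_apply]
        refine tsum_congr fun y => ?_
        rw [mul_apply, ← tsum_mul_right]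
        exact tsum_congr fun z => mul_assoc _ _ _
    _ = ∑' z, ∑' y, f z * (g (z⁻¹ * y) * h (y⁻¹ * x)) := (key'.tsum_comm).symm
    _ = (f * (g * h)) x := by
        rw [mul_apply]
        refine tsum_congr fun z => ?_
        rw [mul_apply, ← tsum_mul_left,
          ← (Equiv.mulLeft z).tsum_eq fun y => f z * (g (z⁻¹ * y) * h (y⁻¹ * x))]
        refine tsum_congr fun y => ?_
        simp [mul_assoc]

instance instNonUnitalNormedRing : NonUnitalNormedRing (WeightedL1 ω) :=
  { instNormedAddCommGroup, instMul with
    left_distrib := fun f g h => by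
      ext x
      simp only [mul_apply, add_apply, mul_add]
      exact (summable_conv f g x).tsum_add (summable_conv f h x)
    right_distrib := fun f g h => by
      ext x
      simp only [mul_apply, add_apply, add_mul]
      exact (summable_conv f h x).tsum_add (summable_conv g h x)
    zero_mul := fun f => by ext x; simp [mul_apply]
    mul_zero := fun f => by ext x; simp [mul_apply]
    mul_assoc := mul_assoc'
    norm_mul_le := norm_mul_le' }

instance instIsScalarTower : IsScalarTower ℂ (WeightedL1 ω) (WeightedL1 ω) where
  smul_assoc c f g := by
    ext x
    simp only [smul_eq_mul, mul_apply, smul_apply, mul_assoc]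
    exact tsum_mul_left

instance instSMulCommClass : SMulCommClass ℂ (WeightedL1 ω) (WeightedL1 ω) where
  smul_comm c f g := by
    ext x
    simp only [smul_eq_mul, mul_apply, smul_apply]
    rw [← tsum_mul_left]
    exact tsum_congr fun y => by ring

end WeightedL1

end WeightedL1

end

/-!
An operator algebra structure on `ℓ¹(G, ω)` makes it injective by Grothendieck's inequality, and the
converse holds because the iterated multiplication of an injective algebra is dominated by positive
functionals.

*From operator algebra to injective algebra.* If `π` represents `ℓ¹(G, ω)` on a Hilbert space, then
`⟨η, π(a) π(b) ξ⟩` is a bilinear form in `(a, b)` that factors through a Hilbert space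
(`exists_hilbertForm_eq`). On `ℓ¹` such forms are bounded for the injective norm
(`isHilbertBound_injectiveTensorNorm`). To see this, the Hilbert space vectors are replaced by
Rademacher sums. Truncating these at a fixed height leaves an average of products of bounded
functionals, while the discarded parts are small in `L²` by the fourth moment estimate. Hence the
best constant `N` on a tensor `t` satisfies `N ≤ 64 ε(t) + N / 2` (`isHilbertBound_step`).

*From injective algebra to operator algebra.* Iterating the boundedness of the multiplication, one
finds that multiplying out words of length `n` is bounded by `Dⁿ⁺¹` for the `n`-fold injective norm
(`norm_sum_smul_delta_prod_le`), that is, for the supremum norm when words are regarded as functions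
on a compact space of sequences of functionals (`wordEval`). So for each `φ` with `|φ| ≤ ω` the
functional `w ↦ φ(∏ w)` on words is dominated by one positive functional on continuous functions
(`exists_isPositiveFunctional_dominating`), with weights `(2D)ⁿ` on the words of length `n`. The
positive functionals define a semi-inner product on the linear combinations of words for which
prepending the letter `x` is an operator of norm at most `2 D ω(x)`, and for which the functionals
`w ↦ φ(∏ w)` are bounded. The combinations that vanish when multiplied out in `G` form a subspace
invariant under these operators. Passing to the quotient Hilbert space gives a representation of
`G` (`isIsomorphicToOperatorAlgebra_of_quotient`). It extends to `ℓ¹(G, ω)`, and it is bounded below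
there since each `f` is normed by some `φ`.
-/

noncomputable section

/-! ### Point masses and the universal property of weighted `ℓ¹` -/

namespace WeightedL1

variable {G : Type u} [Group G] {ω : GroupWeight G}

open Classical in
/-- The point mass at `x`. -/
def delta (ω : GroupWeight G) (x : G) : WeightedL1 ω :=
  ⟨Pi.single x 1, summable_of_ne_finset_zero (s := {x}) fun y hy => by
    simp [Pi.single_eq_of_ne (Finset.notMem_singleton.1 hy)]⟩

open Classical in
theorem delta_apply (x y : G) : delta ω x y = if y = x then 1 else 0 := by
  change (Pi.single x 1 : G → ℂ) y = _
  rw [Pi.single_apply]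

theorem norm_delta (x : G) : ‖delta ω x‖ = ω x := by
  classical
  rw [norm_def, tsum_eq_single x fun y hy => by simp [delta_apply, hy]]
  simp [delta_apply]

theorem delta_mul_delta (x y : G) : delta ω x * delta ω y = delta ω (x * y) := by
  classical
  ext z
  rw [mul_apply, tsum_eq_single x fun a ha => by simp [delta_apply, ha]]
  simp [delta_apply, inv_mul_eq_iff_eq_mul]

/-- Evaluation at a point of the group, as a bounded functional. -/
def eval (ω : GroupWeight G) (x : G) : WeightedL1 ω →L[ℂ] ℂ :=
  LinearMap.mkContinuous
    { toFun := fun f => f x, map_add' := fun _ _ => rfl, map_smul' := fun _ _ => rfl }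
    (ω x)⁻¹ fun f => by
      rw [inv_mul_eq_div, le_div_iff₀ (ω.pos x)]
      exact f.term_le_norm x

@[simp] theorem eval_apply (x : G) (f : WeightedL1 ω) : eval ω x f = f x := rfl

theorem hasSum_delta (f : WeightedL1 ω) : HasSum (fun x => f x • delta ω x) f := by
  classical
  have hs : Summable fun x => f x • delta ω x :=
    Summable.of_norm (f.summable.congr fun x => by rw [norm_smul, norm_delta])
  convert! hs.hasSum
  ext y
  rw [← eval_apply y (∑' x, _), (eval ω y).map_tsum hs,
    tsum_eq_single y fun x hx => by simp [delta_apply, hx.symm]]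
  simp [delta_apply]

section Lift

variable {E : Type*} [NormedAddCommGroup E] [NormedSpace ℂ E]

/-- Bounded linear maps on `ℓ¹(G, ω)` are determined by their values on point masses. -/
theorem clm_ext {S T : WeightedL1 ω →L[ℂ] E} (h : ∀ x, S (delta ω x) = T (delta ω x)) :
    S = T := by
  ext f
  refine (S.hasSum (hasSum_delta f)).unique ?_
  simpa [h] using T.hasSum (hasSum_delta f)

theorem norm_clm_delta_le {C : ℝ} (T : WeightedL1 ω →L[ℂ] E) (hT : ‖T‖ ≤ C) (x : G) :
    ‖T (delta ω x)‖ ≤ C * ω x := by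
  simpa [norm_delta] using T.le_of_opNorm_le hT (delta ω x)

theorem norm_smul_le_of_le {u : G → E} {C : ℝ} (hu : ∀ x, ‖u x‖ ≤ C * ω x) (f : WeightedL1 ω)
    (x : G) : ‖f x • u x‖ ≤ C * (‖f x‖ * ω x) := by
  rw [norm_smul]
  exact (mul_le_mul_of_nonneg_left (hu x) (norm_nonneg _)).trans_eq (by ring)

variable [CompleteSpace E]

theorem summable_smul {u : G → E} {C : ℝ} (hu : ∀ x, ‖u x‖ ≤ C * ω x) (f : WeightedL1 ω) :
    Summable fun x => f x • u x :=
  Summable.of_norm_bounded (f.summable.mul_left C) (norm_smul_le_of_le hu f)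

/-- The universal property of `ℓ¹(G, ω)`: a family `u` with `‖u x‖ ≤ C * ω x` is the restriction
to point masses of a bounded linear map. -/
def lift (u : G → E) (C : ℝ) (hu : ∀ x, ‖u x‖ ≤ C * ω x) : WeightedL1 ω →L[ℂ] E :=
  LinearMap.mkContinuous
    { toFun := fun f => ∑' x, f x • u x
      map_add' := fun f g => by
        simp only [add_apply, add_smul]
        exact (summable_smul hu f).tsum_add (summable_smul hu g)
      map_smul' := fun c f => by
        simp only [smul_apply, mul_smul, RingHom.id_apply]
        exact (summable_smul hu f).tsum_const_smul c }
    C fun f => by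
      rw [norm_def, ← tsum_mul_left]
      exact tsum_of_norm_bounded (f.summable.mul_left C).hasSum (norm_smul_le_of_le hu f)

variable {u : G → E} {C : ℝ} (hu : ∀ x, ‖u x‖ ≤ C * ω x)

theorem lift_apply (f : WeightedL1 ω) : lift u C hu f = ∑' x, f x • u x := rfl

theorem norm_lift_le (hC : 0 ≤ C) : ‖lift u C hu‖ ≤ C :=
  LinearMap.mkContinuous_norm_le _ hC _

@[simp] theorem lift_delta (x : G) : lift u C hu (delta ω x) = u x := by
  classical
  rw [lift_apply, tsum_eq_single x fun y hy => by simp [delta_apply, hy]]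
  simp [delta_apply]

end Lift

/-- A multiplicative family induces an algebra homomorphism. -/
theorem lift_mul {B : Type*} [NormedRing B] [NormedAlgebra ℂ B] [CompleteSpace B] {ρ : G → B}
    {C : ℝ} (hρ : ∀ x, ‖ρ x‖ ≤ C * ω x) (hmul : ∀ x y, ρ (x * y) = ρ x * ρ y)
    (f g : WeightedL1 ω) : lift ρ C hρ (f * g) = lift ρ C hρ f * lift ρ C hρ g := by
  have h1 : ∀ x, lift ρ C hρ (delta ω x * g) = ρ x * lift ρ C hρ g := fun x => by
    have : (lift ρ C hρ).comp (ContinuousLinearMap.mul ℂ (WeightedL1 ω) (delta ω x)) =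
        (ContinuousLinearMap.mul ℂ B (ρ x)).comp (lift ρ C hρ) :=
      clm_ext fun y => by simp [delta_mul_delta, hmul]
    exact DFunLike.congr_fun this g
  have : (lift ρ C hρ).comp ((ContinuousLinearMap.mul ℂ (WeightedL1 ω)).flip g) =
      ((ContinuousLinearMap.mul ℂ B).flip (lift ρ C hρ g)).comp (lift ρ C hρ) :=
    clm_ext fun x => by simp [h1]
  exact DFunLike.congr_fun this f

end WeightedL1

/-! ### Rademacher sums -/

section Rademacher

variable {ι : Type*}

/-- The Rademacher sum `∑ k ∈ s, σ k * u k` for a choice of signs `σ`. -/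
def radSum (s : Finset ι) (u : ι → ℂ) (σ : ι → ℤˣ) : ℂ := ∑ k ∈ s, ((σ k : ℤ) : ℂ) * u k

theorem conj_radSum (s : Finset ι) (u : ι → ℂ) (σ : ι → ℤˣ) :
    starRingEnd ℂ (radSum s u σ) = radSum s (fun k => starRingEnd ℂ (u k)) σ := by
  simp [radSum]

variable [DecidableEq ι]

theorem radSum_insert_update {s : Finset ι} {k : ι} (hk : k ∉ s) (u : ι → ℂ) (σ : ι → ℤˣ) :
    radSum (insert k s) u (Function.update σ k (-σ k)) =
      radSum s u σ - ((σ k : ℤ) : ℂ) * u k := by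
  have : radSum s u (Function.update σ k (-σ k)) = radSum s u σ :=
    Finset.sum_congr rfl fun j hj => by
      rw [Function.update_of_ne (ne_of_mem_of_not_mem hj hk)]
  rw [← this]
  simp only [radSum, Finset.sum_insert hk, Function.update_self, Units.val_neg, Int.cast_neg]
  ring

theorem radSum_insert {s : Finset ι} {k : ι} (hk : k ∉ s) (u : ι → ℂ) (σ : ι → ℤˣ) :
    radSum (insert k s) u σ = radSum s u σ + ((σ k : ℤ) : ℂ) * u k := by
  rw [radSum, Finset.sum_insert hk, add_comm, radSum]

theorem sign_sq (a : ℤˣ) : ((a : ℤ) : ℂ) * ((a : ℤ) : ℂ) = 1 := by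
  rcases Int.units_eq_one_or a with rfl | rfl <;> simp

theorem norm_sign (a : ℤˣ) : ‖((a : ℤ) : ℂ)‖ = 1 := by
  rcases Int.units_eq_one_or a with rfl | rfl <;> simp

variable [Fintype ι]

/-- Averaging over the sign of one coordinate. -/
theorem two_mul_sum_signs {E : Type*} [Field E] (k : ι) (g : (ι → ℤˣ) → E) :
    2 * ∑ σ, g σ = ∑ σ, (g σ + g (Function.update σ k (-σ k))) := by
  let e : (ι → ℤˣ) ≃ (ι → ℤˣ) :=
    Function.Involutive.toPerm (fun σ => Function.update σ k (-σ k)) fun σ => by simp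
  rw [Finset.sum_add_distrib, two_mul]
  congr 1
  exact (e.sum_comp g).symm

/-- Rademacher sums are orthogonal. -/
theorem sum_radSum_mul (s : Finset ι) (u v : ι → ℂ) :
    ∑ σ, radSum s u σ * radSum s v σ =
      (Fintype.card (ι → ℤˣ) : ℂ) * ∑ k ∈ s, u k * v k := by
  induction s using Finset.induction_on with
  | empty => simp [radSum]
  | insert k s hk ih =>
    refine mul_left_cancel₀ (two_ne_zero (α := ℂ)) ?_
    rw [two_mul_sum_signs k, Finset.sum_insert hk, mul_add (Fintype.card _ : ℂ), ← ih]
    have : ∀ σ : ι → ℤˣ, radSum (insert k s) u σ * radSum (insert k s) v σ +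
        radSum (insert k s) u (Function.update σ k (-σ k)) *
          radSum (insert k s) v (Function.update σ k (-σ k)) =
        2 * (radSum s u σ * radSum s v σ) + 2 * (u k * v k) := fun σ => by
      rw [radSum_insert_update hk, radSum_insert_update hk, radSum_insert hk, radSum_insert hk]
      linear_combination 2 * u k * v k * sign_sq (σ k)
    simp only [this, Finset.sum_add_distrib, ← Finset.mul_sum, Finset.sum_const, Finset.card_univ,
      nsmul_eq_mul]
    ring

theorem sum_norm_radSum_sq (s : Finset ι) (u : ι → ℂ) :
    ∑ σ, ‖radSum s u σ‖ ^ 2 = (Fintype.card (ι → ℤˣ) : ℝ) * ∑ k ∈ s, ‖u k‖ ^ 2 := by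
  have h := sum_radSum_mul s u fun k => starRingEnd ℂ (u k)
  simp only [← conj_radSum, Complex.mul_conj, Complex.normSq_eq_norm_sq] at h
  exact_mod_cast h

/-- The parallelogram-type estimate behind the fourth moment bound. -/
theorem norm_add_pow_four_add_norm_sub_pow_four_le (z w : ℂ) :
    ‖z + w‖ ^ 4 + ‖z - w‖ ^ 4 ≤ 2 * (‖z‖ ^ 4 + 6 * ‖z‖ ^ 2 * ‖w‖ ^ 2 + ‖w‖ ^ 4) := by
  have h : ∀ a : ℂ, ‖a‖ ^ 4 = (a.re ^ 2 + a.im ^ 2) ^ 2 := fun a => by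
    rw [show ‖a‖ ^ 4 = (‖a‖ ^ 2) ^ 2 by ring, ← Complex.normSq_eq_norm_sq, Complex.normSq_apply]
    ring
  have h' : ∀ a : ℂ, ‖a‖ ^ 2 = a.re ^ 2 + a.im ^ 2 := fun a => by
    rw [← Complex.normSq_eq_norm_sq, Complex.normSq_apply]
    ring
  simp only [h, h', Complex.add_re, Complex.add_im, Complex.sub_re, Complex.sub_im]
  nlinarith [sq_nonneg (z.re * w.im - z.im * w.re)]

/-- The Khinchine inequality for fourth moments. -/
theorem sum_norm_radSum_pow_four_le (s : Finset ι) (u : ι → ℂ) :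
    ∑ σ, ‖radSum s u σ‖ ^ 4 ≤
      (Fintype.card (ι → ℤˣ) : ℝ) * (3 * (∑ k ∈ s, ‖u k‖ ^ 2) ^ 2) := by
  induction s using Finset.induction_on with
  | empty => simp [radSum]
  | insert k s hk ih =>
    refine le_of_mul_le_mul_left ?_ (two_pos (α := ℝ))
    rw [two_mul_sum_signs k, Finset.sum_insert hk]
    have : ∀ σ : ι → ℤˣ, ‖radSum (insert k s) u σ‖ ^ 4 +
        ‖radSum (insert k s) u (Function.update σ k (-σ k))‖ ^ 4 ≤
        2 * ‖radSum s u σ‖ ^ 4 + 12 * ‖u k‖ ^ 2 * ‖radSum s u σ‖ ^ 2 + 2 * ‖u k‖ ^ 4 := fun σ => by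
      rw [radSum_insert_update hk, radSum_insert hk]
      refine (norm_add_pow_four_add_norm_sub_pow_four_le _ _).trans_eq ?_
      rw [norm_mul, norm_sign]
      ring
    refine (Finset.sum_le_sum fun σ _ => this σ).trans ?_
    simp only [Finset.sum_add_distrib, ← Finset.mul_sum, Finset.sum_const, Finset.card_univ,
      nsmul_eq_mul, sum_norm_radSum_sq]
    have h4 : 0 ≤ (Fintype.card (ι → ℤˣ) : ℝ) * ‖u k‖ ^ 4 := by positivity
    linarith

end Rademacher

/-! ### Bilinear forms through Hilbert spaces and truncation -/

section HilbertForm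

variable {E F : Type*} [SeminormedAddCommGroup E] [NormedSpace ℂ E]
  [SeminormedAddCommGroup F] [NormedSpace ℂ F] {ι : Type*}

@[simp] theorem dualTensor_tmul (φ : StrongDual ℂ E) (ψ : StrongDual ℂ F) (a : E) (b : F) :
    dualTensor φ ψ (a ⊗ₜ[ℂ] b) = φ a * ψ b := rfl

theorem injectiveTensorNorm_nonneg (t : E ⊗[ℂ] F) : 0 ≤ injectiveTensorNorm t :=
  Real.iSup_nonneg fun _ => norm_nonneg _

theorem norm_dualTensor_le {φ : StrongDual ℂ E} {ψ : StrongDual ℂ F} {c d : ℝ} (hc : 0 < c)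
    (hd : 0 < d) (hφ : ‖φ‖ ≤ c) (hψ : ‖ψ‖ ≤ d) (t : E ⊗[ℂ] F) :
    ‖dualTensor φ ψ t‖ ≤ c * d * injectiveTensorNorm t := by
  have h1 : dualTensor φ ψ = ((c : ℂ) * d) • dualTensor ((c : ℂ)⁻¹ • φ) ((d : ℂ)⁻¹ • ψ) := by
    refine TensorProduct.ext' fun a b => ?_
    have : (c : ℂ) ≠ 0 := by exact_mod_cast hc.ne'
    have : (d : ℂ) ≠ 0 := by exact_mod_cast hd.ne'
    simp only [dualTensor_tmul, LinearMap.smul_apply, _root_.smul_apply, smul_eq_mul]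
    field_simp
  have hφ' : (c : ℂ)⁻¹ • φ ∈ Metric.closedBall (0 : StrongDual ℂ E) 1 := by
    rw [mem_closedBall_zero_iff, norm_smul, norm_inv, Complex.norm_of_nonneg hc.le,
      inv_mul_le_iff₀ hc, mul_one]
    exact hφ
  have hψ' : (d : ℂ)⁻¹ • ψ ∈ Metric.closedBall (0 : StrongDual ℂ F) 1 := by
    rw [mem_closedBall_zero_iff, norm_smul, norm_inv, Complex.norm_of_nonneg hd.le,
      inv_mul_le_iff₀ hd, mul_one]
    exact hψ
  rw [h1, LinearMap.smul_apply, norm_smul, norm_mul, Complex.norm_of_nonneg hc.le,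
    Complex.norm_of_nonneg hd.le]
  exact mul_le_mul_of_nonneg_left
    (le_ciSup (bddAbove_injectiveTensorNorm t) (⟨⟨_, hφ'⟩, ⟨_, hψ'⟩⟩ : DualBalls E F))
    (by positivity)

variable [Fintype ι]

/-- The bilinear form `(a, b) ↦ ∑ k, (V a)ₖ (U b)ₖ` that factors through a finite-dimensional
Hilbert space, as a functional on the tensor product. -/
def hilbertForm (V : E →L[ℂ] EuclideanSpace ℂ ι) (U : F →L[ℂ] EuclideanSpace ℂ ι) :
    E ⊗[ℂ] F →ₗ[ℂ] ℂ :=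
  ∑ k, dualTensor ((EuclideanSpace.proj k).comp V) ((EuclideanSpace.proj k).comp U)

variable (V V' : E →L[ℂ] EuclideanSpace ℂ ι) (U U' : F →L[ℂ] EuclideanSpace ℂ ι)

theorem hilbertForm_tmul (a : E) (b : F) :
    hilbertForm V U (a ⊗ₜ[ℂ] b) = ∑ k, V a k * U b k := by
  simp [hilbertForm]

theorem hilbertForm_add_left : hilbertForm (V + V') U = hilbertForm V U + hilbertForm V' U :=
  TensorProduct.ext' fun a b => by
    simp [hilbertForm_tmul, add_mul, Finset.sum_add_distrib]

theorem hilbertForm_add_right : hilbertForm V (U + U') = hilbertForm V U + hilbertForm V U' :=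
  TensorProduct.ext' fun a b => by
    simp [hilbertForm_tmul, mul_add, Finset.sum_add_distrib]

theorem hilbertForm_smul_smul (c d : ℂ) :
    hilbertForm (c • V) (d • U) = (c * d) • hilbertForm V U :=
  TensorProduct.ext' fun a b => by
    simp [hilbertForm_tmul, Finset.mul_sum, mul_mul_mul_comm]

/-- `N` bounds, on the tensor `t`, all forms that factor contractively through a Hilbert space. -/
def IsHilbertBound (t : E ⊗[ℂ] F) (N : ℝ) : Prop :=
  ∀ (ι : Type) [Fintype ι] (V : E →L[ℂ] EuclideanSpace ℂ ι) (U : F →L[ℂ] EuclideanSpace ℂ ι),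
    ‖V‖ ≤ 1 → ‖U‖ ≤ 1 → ‖hilbertForm V U t‖ ≤ N

theorem exists_isHilbertBound (t : E ⊗[ℂ] F) : ∃ N, IsHilbertBound t N := by
  induction t using TensorProduct.induction_on with
  | zero => exact ⟨0, fun ι _ V U _ _ => by simp⟩
  | tmul a b =>
    refine ⟨‖a‖ * ‖b‖, fun ι _ V U hV hU => ?_⟩
    rw [hilbertForm_tmul]
    calc ‖∑ k, V a k * U b k‖ ≤ ∑ k, ‖V a k‖ * ‖U b k‖ :=
          (norm_sum_le _ _).trans_eq (by simp)
      _ ≤ √(∑ k, ‖V a k‖ ^ 2) * √(∑ k, ‖U b k‖ ^ 2) := Real.sum_mul_le_sqrt_mul_sqrt _ _ _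
      _ = ‖V a‖ * ‖U b‖ := by rw [EuclideanSpace.norm_eq, EuclideanSpace.norm_eq]
      _ ≤ ‖a‖ * ‖b‖ := mul_le_mul ((V.le_of_opNorm_le hV a).trans_eq (one_mul _))
          ((U.le_of_opNorm_le hU b).trans_eq (one_mul _)) (norm_nonneg _) (norm_nonneg _)
  | add s t hs ht =>
    obtain ⟨M, hM⟩ := hs
    obtain ⟨N, hN⟩ := ht
    refine ⟨M + N, fun ι _ V U hV hU => ?_⟩
    rw [map_add]
    exact (norm_add_le _ _).trans (add_le_add (hM ι V U hV hU) (hN ι V U hV hU))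

theorem IsHilbertBound.norm_le {t : E ⊗[ℂ] F} {N : ℝ} (h : IsHilbertBound t N) {ι : Type}
    [Fintype ι] {V : E →L[ℂ] EuclideanSpace ℂ ι} {U : F →L[ℂ] EuclideanSpace ℂ ι} {c d : ℝ}
    (hc : 0 < c) (hd : 0 < d) (hV : ‖V‖ ≤ c) (hU : ‖U‖ ≤ d) :
    ‖hilbertForm V U t‖ ≤ c * d * N := by
  have hc' : (c : ℂ) ≠ 0 := by exact_mod_cast hc.ne'
  have hd' : (d : ℂ) ≠ 0 := by exact_mod_cast hd.ne'
  have key := h ι ((c : ℂ)⁻¹ • V) ((d : ℂ)⁻¹ • U)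
    (by rwa [norm_smul, norm_inv, Complex.norm_of_nonneg hc.le, inv_mul_le_iff₀ hc, mul_one])
    (by rwa [norm_smul, norm_inv, Complex.norm_of_nonneg hd.le, inv_mul_le_iff₀ hd, mul_one])
  rw [hilbertForm_smul_smul, LinearMap.smul_apply, norm_smul, norm_mul, norm_inv, norm_inv,
    Complex.norm_of_nonneg hc.le, Complex.norm_of_nonneg hd.le, ← mul_inv,
    inv_mul_le_iff₀ (by positivity)] at key
  exact key

end HilbertForm

section Truncation

variable {ι : Type*}

/-- The coordinates of `v` of modulus at most `a`, the others being replaced by zero. -/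
def truncCoord (a : ℝ) (v : EuclideanSpace ℂ ι) : EuclideanSpace ℂ ι :=
  WithLp.toLp 2 fun k => if ‖v k‖ ≤ a then v k else 0

theorem truncCoord_apply (a : ℝ) (v : EuclideanSpace ℂ ι) (k : ι) :
    truncCoord a v k = if ‖v k‖ ≤ a then v k else 0 := rfl

theorem norm_truncCoord_apply_le {a : ℝ} (ha : 0 ≤ a) (v : EuclideanSpace ℂ ι) (k : ι) :
    ‖truncCoord a v k‖ ≤ a := by
  rw [truncCoord_apply]
  split_ifs with h
  · exact h
  · simpa using ha

variable [Fintype ι]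

theorem norm_truncCoord_le (a : ℝ) (v : EuclideanSpace ℂ ι) : ‖truncCoord a v‖ ≤ ‖v‖ := by
  rw [EuclideanSpace.norm_eq, EuclideanSpace.norm_eq]
  refine Real.sqrt_le_sqrt (Finset.sum_le_sum fun k _ => ?_)
  rw [truncCoord_apply]
  split_ifs with h
  · exact le_rfl
  · simp

theorem norm_sub_truncCoord_sq_le {a : ℝ} (ha : 0 < a) (v : EuclideanSpace ℂ ι) :
    ‖v - truncCoord a v‖ ^ 2 ≤ (∑ k, ‖v k‖ ^ 4) / a ^ 2 := by
  rw [EuclideanSpace.norm_sq_eq, Finset.sum_div]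
  refine Finset.sum_le_sum fun k _ => ?_
  rw [PiLp.sub_apply, truncCoord_apply]
  split_ifs with h
  · simp; positivity
  · rw [sub_zero, le_div_iff₀ (by positivity)]
    have : a ^ 2 ≤ ‖v k‖ ^ 2 := by gcongr; exact (not_le.1 h).le
    nlinarith [sq_nonneg ‖v k‖]

variable [DecidableEq ι]

/-- The isometric embedding of `ℓ²` into `L²` of the sign group by Rademacher sums. -/
def radIsometry (ι : Type*) [Fintype ι] [DecidableEq ι] :
    EuclideanSpace ℂ ι →ₗᵢ[ℂ] EuclideanSpace ℂ (ι → ℤˣ) where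
  toFun u := WithLp.toLp 2 fun σ =>
    ((√(Fintype.card (ι → ℤˣ)))⁻¹ : ℝ) * radSum Finset.univ u σ
  map_add' u v := by
    ext σ
    simp [radSum, mul_add, Finset.sum_add_distrib]
  map_smul' c u := by
    ext σ
    simp only [radSum, PiLp.smul_apply, smul_eq_mul, RingHom.id_apply, Finset.mul_sum]
    exact Finset.sum_congr rfl fun k _ => by ring
  norm_map' u := by
    have h : (0 : ℝ) < Fintype.card (ι → ℤˣ) := by exact_mod_cast Fintype.card_pos
    rw [← sq_eq_sq₀ (norm_nonneg _) (norm_nonneg _), EuclideanSpace.norm_sq_eq,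
      EuclideanSpace.norm_sq_eq]
    simp only [LinearMap.coe_mk, AddHom.coe_mk, norm_mul, mul_pow, Complex.norm_real, norm_inv,
      Real.norm_eq_abs, sq_abs, inv_pow, Real.sq_sqrt h.le]
    rw [← Finset.mul_sum, sum_norm_radSum_sq, inv_mul_cancel_left₀ h.ne']

theorem radIsometry_apply (u : EuclideanSpace ℂ ι) (σ : ι → ℤˣ) :
    radIsometry ι u σ = ((√(Fintype.card (ι → ℤˣ)))⁻¹ : ℝ) * radSum Finset.univ u σ := rfl

theorem sum_radIsometry_mul (u v : EuclideanSpace ℂ ι) :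
    ∑ σ, radIsometry ι u σ * radIsometry ι v σ = ∑ k, u k * v k := by
  have h : (0 : ℝ) < Fintype.card (ι → ℤˣ) := by exact_mod_cast Fintype.card_pos
  simp only [radIsometry_apply]
  rw [Finset.sum_congr rfl fun σ _ => mul_mul_mul_comm _ _ _ _, ← Finset.mul_sum, sum_radSum_mul,
    ← Complex.ofReal_mul, ← mul_inv, Real.mul_self_sqrt h.le,
    ← mul_assoc]
  push_cast
  rw [inv_mul_cancel₀ (by exact_mod_cast h.ne'), one_mul]

/-- A Rademacher sum is close in `L²` to its truncation at `8` times its norm. -/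
theorem norm_radIsometry_sub_truncCoord_le {u : EuclideanSpace ℂ ι} {r : ℝ} (hr : 0 < r)
    (hu : ‖u‖ ≤ r) :
    ‖radIsometry ι u - truncCoord ((√(Fintype.card (ι → ℤˣ)))⁻¹ * (8 * r)) (radIsometry ι u)‖ ≤
      1 / 4 * r := by
  have h : (0 : ℝ) < Fintype.card (ι → ℤˣ) := by exact_mod_cast Fintype.card_pos
  refine (sq_le_sq₀ (norm_nonneg _) (by positivity)).1 ?_
  refine (norm_sub_truncCoord_sq_le (by positivity) _).trans ?_
  rw [div_le_iff₀ (by positivity)]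
  simp only [radIsometry_apply, norm_mul, mul_pow, Complex.norm_real, norm_inv,
    Real.norm_eq_abs, inv_pow, abs_of_nonneg (Real.sqrt_nonneg _)]
  rw [← Finset.mul_sum, show (√(Fintype.card (ι → ℤˣ) : ℝ)) ^ 4 =
    ((√(Fintype.card (ι → ℤˣ) : ℝ)) ^ 2) ^ 2 by ring, Real.sq_sqrt h.le]
  have h4 := sum_norm_radSum_pow_four_le Finset.univ u
  rw [← EuclideanSpace.norm_sq_eq] at h4
  have hu2 : (‖u‖ ^ 2) ^ 2 ≤ r ^ 4 := by
    rw [← pow_mul]; gcongr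
  calc _ ≤ ((Fintype.card (ι → ℤˣ) : ℝ) ^ 2)⁻¹ *
        ((Fintype.card (ι → ℤˣ) : ℝ) * (3 * r ^ 4)) := by
        gcongr
        exact h4.trans (by gcongr)
    _ = (Fintype.card (ι → ℤˣ) : ℝ)⁻¹ * (3 * r ^ 4) := by field_simp
    _ ≤ (Fintype.card (ι → ℤˣ) : ℝ)⁻¹ * (4 * r ^ 4) := by gcongr; norm_num
    _ = _ := by ring

end Truncation

/-! ### Grothendieck's inequality and operator algebras -/

section Grothendieck

variable {G : Type u} [Group G] {ω : GroupWeight G}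

theorem WeightedL1.norm_clm_le {E : Type*} [NormedAddCommGroup E] [NormedSpace ℂ E]
    [CompleteSpace E] {C : ℝ} (hC : 0 ≤ C) (T : WeightedL1 ω →L[ℂ] E)
    (hT : ∀ x, ‖T (delta ω x)‖ ≤ C * ω x) : ‖T‖ ≤ C := by
  rw [show T = lift (fun x => T (delta ω x)) C hT from clm_ext fun x => by simp]
  exact norm_lift_le hT hC

/-- The truncation step: replacing the vectors `U δₓ` by Rademacher sums, a form on `ℓ¹` that
factors through a Hilbert space is, up to two forms with a better bound, an average of tensor
products of bounded functionals. -/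
theorem isHilbertBound_step {t : WeightedL1 ω ⊗[ℂ] WeightedL1 ω} {N : ℝ}
    (h : IsHilbertBound t N) : IsHilbertBound t (64 * injectiveTensorNorm t + N / 2) := by
  classical
  intro ι _ V U hV hU
  have hn : (0 : ℝ) < Fintype.card (ι → ℤˣ) := by exact_mod_cast Fintype.card_pos
  set c : ℝ := (√(Fintype.card (ι → ℤˣ)))⁻¹ with hc
  have hc0 : 0 < c := by positivity
  let r := (radIsometry ι).toContinuousLinearMap
  have hr : ‖r‖ ≤ 1 := (radIsometry ι).norm_toContinuousLinearMap_le
  -- the truncated parts of the two maps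
  have htr : ∀ W : WeightedL1 ω →L[ℂ] EuclideanSpace ℂ ι, ‖W‖ ≤ 1 →
      ∃ T : WeightedL1 ω →L[ℂ] EuclideanSpace ℂ (ι → ℤˣ), ‖T‖ ≤ 1 ∧ ‖r.comp W - T‖ ≤ 1 / 4 ∧
        ∀ σ, ‖(EuclideanSpace.proj σ).comp T‖ ≤ c * 8 := by
    intro W hW
    have hx : ∀ x, ‖W (WeightedL1.delta ω x)‖ ≤ ω x := fun x => by
      simpa using WeightedL1.norm_clm_delta_le W hW x
    have hb : ∀ x, ‖truncCoord (c * (8 * ω x)) (r (W (WeightedL1.delta ω x)))‖ ≤ 1 * ω x :=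
      fun x => (norm_truncCoord_le _ _).trans (by
        rw [one_mul]
        exact ((radIsometry ι).norm_map _).le.trans (hx x))
    refine ⟨WeightedL1.lift _ 1 hb, WeightedL1.norm_lift_le hb zero_le_one,
      WeightedL1.norm_clm_le (by norm_num) _ fun x => ?_, fun σ =>
      WeightedL1.norm_clm_le (by positivity) _ fun x => ?_⟩
    · simp only [_root_.sub_apply, ContinuousLinearMap.comp_apply, WeightedL1.lift_delta]
      exact norm_radIsometry_sub_truncCoord_le (ω.pos x) (hx x)
    · simp only [ContinuousLinearMap.comp_apply, WeightedL1.lift_delta, PiLp.proj_apply]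
      exact (norm_truncCoord_apply_le (by have := ω.pos x; positivity) _ σ).trans_eq (by ring)
  obtain ⟨S, hS1, hS2, hS3⟩ := htr V hV
  obtain ⟨T, hT1, hT2, hT3⟩ := htr U hU
  have hrad : hilbertForm V U = hilbertForm (r.comp V) (r.comp U) :=
    TensorProduct.ext' fun a b => by
      rw [hilbertForm_tmul, hilbertForm_tmul]
      exact (sum_radIsometry_mul _ _).symm
  have hsplit : hilbertForm (r.comp V) (r.comp U) =
      hilbertForm S T + hilbertForm S (r.comp U - T) + hilbertForm (r.comp V - S) (r.comp U) := by
    rw [← hilbertForm_add_right, add_sub_cancel, ← hilbertForm_add_left, add_sub_cancel]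
  -- each of the products of coordinates is bounded by `(8 c)²`, and there are `c⁻²` of them
  have h1 : ‖hilbertForm S T t‖ ≤ 64 * injectiveTensorNorm t := by
    rw [hilbertForm, LinearMap.sum_apply]
    refine (norm_sum_le_of_le _ fun σ _ =>
      norm_dualTensor_le (by positivity) (by positivity) (hS3 σ) (hT3 σ) t).trans_eq ?_
    rw [Finset.sum_const, Finset.card_univ, nsmul_eq_mul]
    have : c * c = (Fintype.card (ι → ℤˣ) : ℝ)⁻¹ := by
      rw [hc, ← mul_inv, Real.mul_self_sqrt hn.le]
    calc _ = (Fintype.card (ι → ℤˣ) : ℝ) * (c * c) * 64 * injectiveTensorNorm t := by ring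
      _ = _ := by rw [this, mul_inv_cancel₀ hn.ne', one_mul]
  have h2 : ‖hilbertForm S (r.comp U - T) t‖ ≤ 1 * (1 / 4) * N :=
    h.norm_le one_pos (by norm_num) hS1 hT2
  have h3 : ‖hilbertForm (r.comp V - S) (r.comp U) t‖ ≤ 1 / 4 * 1 * N :=
    h.norm_le (by norm_num) one_pos hS2
      ((ContinuousLinearMap.opNorm_comp_le _ _).trans (mul_le_one₀ hr (norm_nonneg _) hU))
  rw [hrad, hsplit, LinearMap.add_apply, LinearMap.add_apply]
  refine (norm_add₃_le).trans ?_
  linarith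

/-- Grothendieck's inequality: on `ℓ¹(G, ω) ⊗ ℓ¹(G, ω)`, the forms that factor contractively through
a Hilbert space are bounded by a multiple of the injective norm. -/
theorem isHilbertBound_injectiveTensorNorm (t : WeightedL1 ω ⊗[ℂ] WeightedL1 ω) :
    IsHilbertBound t (128 * injectiveTensorNorm t) := by
  obtain ⟨N₀, h₀⟩ := exists_isHilbertBound t
  have hbdd : BddBelow {N | IsHilbertBound t N} :=
    ⟨0, fun N hN => (norm_nonneg _).trans (hN PEmpty 0 0 (by simp) (by simp))⟩
  have hne : {N | IsHilbertBound t N}.Nonempty := ⟨N₀, h₀⟩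
  have hinf : IsHilbertBound t (sInf {N | IsHilbertBound t N}) := fun ι _ V U hV hU =>
    le_csInf hne fun N hN => hN ι V U hV hU
  have hle := csInf_le hbdd (isHilbertBound_step hinf)
  exact fun ι _ V U hV hU => (hinf ι V U hV hU).trans (by linarith)

end Grothendieck

section OperatorAlgebra

/-- The matrix coefficient `⟨η, π a (π b ξ)⟩` agrees with a form through a finite-dimensional
Hilbert space on any finite set of pairs `(a, b)`: the vectors `π b ξ` that occur are expanded in an
orthonormal basis of their span. -/
theorem exists_hilbertForm_eq {E H : Type*} [NormedAddCommGroup E] [NormedSpace ℂ E]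
    [NormedAddCommGroup H] [InnerProductSpace ℂ H] [CompleteSpace H]
    (π : E →L[ℂ] (H →L[ℂ] H)) {K : ℝ} (hK : ‖π‖ ≤ K) (ξ η : H) (s : Finset (E × E)) :
    ∃ (n : ℕ) (V U : E →L[ℂ] EuclideanSpace ℂ (Fin n)), ‖V‖ ≤ K * ‖η‖ ∧ ‖U‖ ≤ K * ‖ξ‖ ∧
      ∀ p ∈ s, hilbertForm V U (p.1 ⊗ₜ[ℂ] p.2) = inner ℂ η (π p.1 (π p.2 ξ)) := by
  classical
  have hK0 : 0 ≤ K := (norm_nonneg _).trans hK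
  let S : Submodule ℂ H := Submodule.span ℂ (s.image fun p => π p.2 ξ : Finset H)
  have : FiniteDimensional ℂ S := FiniteDimensional.span_finset ℂ _
  let e := stdOrthonormalBasis ℂ S
  let W : H →L[ℂ] EuclideanSpace ℂ (Fin (Module.finrank ℂ S)) :=
    (e.repr.toContinuousLinearEquiv : S →L[ℂ] EuclideanSpace ℂ _).comp S.orthogonalProjectionOnto
  have hW : ∀ v, ‖W v‖ ≤ ‖v‖ := fun v => by
    simpa [W] using S.norm_orthogonalProjectionOnto_apply_le v
  have hWe : ∀ v ∈ S, ∑ k, W v k • (e k : H) = v := fun v hv => by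
    have := congrArg (Subtype.val) (e.sum_repr ⟨v, hv⟩)
    have hp : S.orthogonalProjectionOnto v = ⟨v, hv⟩ :=
      S.orthogonalProjectionOnto_mem_subspace_eq_self ⟨v, hv⟩
    simpa [W, hp] using this
  have he : Orthonormal ℂ fun k => (e k : H) := e.orthonormal.comp_linearIsometry S.subtypeₗᵢ
  let V : E →L[ℂ] EuclideanSpace ℂ (Fin (Module.finrank ℂ S)) :=
    LinearMap.mkContinuous
      { toFun := fun a => WithLp.toLp 2 fun k => inner ℂ η (π a (e k))
        map_add' := fun a b => by ext k; simp
        map_smul' := fun c a => by ext k; simp }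
      (K * ‖η‖) fun a => by
        refine (sq_le_sq₀ (norm_nonneg _) (by positivity)).1 ?_
        rw [EuclideanSpace.norm_sq_eq]
        calc ∑ k, ‖inner ℂ η (π a (e k))‖ ^ 2
            = ∑ k, ‖inner ℂ (e k : H) (ContinuousLinearMap.adjoint (π a) η)‖ ^ 2 :=
              Finset.sum_congr rfl fun k _ => by
                rw [ContinuousLinearMap.adjoint_inner_right, norm_inner_symm]
          _ ≤ ‖ContinuousLinearMap.adjoint (π a) η‖ ^ 2 := he.sum_inner_products_le _
          _ ≤ (K * ‖η‖ * ‖a‖) ^ 2 := by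
              gcongr
              refine (ContinuousLinearMap.le_opNorm _ _).trans ?_
              rw [LinearIsometryEquiv.norm_map]
              calc ‖π a‖ * ‖η‖ ≤ K * ‖a‖ * ‖η‖ := by
                    gcongr
                    exact π.le_of_opNorm_le hK a
                _ = _ := by ring
  refine ⟨_, V, W.comp (π.flip ξ), LinearMap.mkContinuous_norm_le _ (by positivity) _,
    ContinuousLinearMap.opNorm_le_bound _ (by positivity) fun b => ?_, fun p hp => ?_⟩
  · refine (hW (π b ξ)).trans (((π b).le_opNorm ξ).trans ?_)
    calc ‖π b‖ * ‖ξ‖ ≤ K * ‖b‖ * ‖ξ‖ := by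
          gcongr
          exact π.le_of_opNorm_le hK b
      _ = _ := by ring
  · rw [hilbertForm_tmul]
    have hmem : π p.2 ξ ∈ S := Submodule.subset_span (by
      simp only [Finset.coe_image, Set.mem_image, Finset.mem_coe]
      exact ⟨p, hp, rfl⟩)
    conv_rhs => rw [← hWe _ hmem, map_sum, inner_sum]
    refine Finset.sum_congr rfl fun k _ => ?_
    rw [map_smul, inner_smul_right, mul_comm]
    rfl

variable {G : Type u} [Group G] {ω : GroupWeight G}

theorem norm_map_mul'_le {H : Type*} [NormedAddCommGroup H] [InnerProductSpace ℂ H]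
    [CompleteSpace H] (π : WeightedL1 ω →L[ℂ] (H →L[ℂ] H))
    (hπ : ∀ a b, π (a * b) = π a * π b) {K : ℝ} (hK0 : 0 < K) (hK : ‖π‖ ≤ K)
    (t : WeightedL1 ω ⊗[ℂ] WeightedL1 ω) :
    ‖π (LinearMap.mul' ℂ (WeightedL1 ω) t)‖ ≤ 128 * K ^ 2 * injectiveTensorNorm t := by
  have hε := injectiveTensorNorm_nonneg t
  refine ContinuousLinearMap.opNorm_le_of_re_inner_le (by positivity) fun ξ η hξ hη => ?_
  obtain ⟨s, hs⟩ := TensorProduct.exists_finset t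
  obtain ⟨n, V, U, hV, hU, h⟩ := exists_hilbertForm_eq π hK ξ η s
  rw [hη, mul_one] at hV
  rw [hξ, mul_one] at hU
  have key : hilbertForm V U t = inner ℂ η (π (LinearMap.mul' ℂ (WeightedL1 ω) t) ξ) := by
    rw [hs]
    simp only [map_sum, _root_.sum_apply, inner_sum, LinearMap.mul'_apply, hπ]
    exact Finset.sum_congr rfl h
  refine (RCLike.re_le_norm _).trans ?_
  rw [norm_inner_symm, ← key]
  refine ((isHilbertBound_injectiveTensorNorm t).norm_le hK0 hK0 hV hU).trans_eq ?_
  ring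

theorem isInjectiveAlgebra_of_isIsomorphicToOperatorAlgebra
    (h : IsIsomorphicToOperatorAlgebra.{u, w} (WeightedL1 ω)) :
    IsInjectiveAlgebra (WeightedL1 ω) := by
  obtain ⟨H, _, _, _, B, ψ, -, hψ⟩ := h
  let π : WeightedL1 ω →L[ℂ] (H →L[ℂ] H) :=
    B.toSubmodule.subtypeL.comp (ψ : WeightedL1 ω →L[ℂ] B)
  have hπ : ∀ a b, π (a * b) = π a * π b := fun a b => congrArg Subtype.val (hψ a b)
  set K := ‖π‖ + 1
  have hK0 : 0 < K := by positivity
  let ψ' : B.toSubmodule →L[ℂ] WeightedL1 ω := (ψ.symm : B →L[ℂ] WeightedL1 ω)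
  have hC : ∀ a, ‖a‖ ≤ ‖ψ'‖ * ‖π a‖ := fun a => by
    have := ψ'.le_opNorm (ψ a)
    rwa [show ψ' (ψ a) = a from ψ.symm_apply_apply a] at this
  let m₀ : AlgInjectiveTensor (WeightedL1 ω) (WeightedL1 ω) →L[ℂ] WeightedL1 ω :=
    LinearMap.mkContinuous (LinearMap.mul' ℂ (WeightedL1 ω)) (‖ψ'‖ * (128 * K ^ 2)) fun t => by
      refine (hC _).trans ?_
      rw [mul_assoc ‖ψ'‖]
      exact mul_le_mul_of_nonneg_left
        (norm_map_mul'_le π hπ hK0 (by simp [K]) t) (ContinuousLinearMap.opNorm_nonneg ψ')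
  refine ⟨m₀.extend UniformSpace.Completion.toComplL, fun a b => ?_⟩
  exact m₀.extend_eq UniformSpace.Completion.denseRange_coe
    (UniformSpace.Completion.isUniformInducing_coe _) _

end OperatorAlgebra

/-! ### Representations on quotients of semi-inner product spaces -/

section Representation

variable {G : Type u} [Group G] {ω : GroupWeight G}

/-- A multiplicative bounded map into `B(H)` that is bounded below identifies the algebra with a
closed subalgebra of `B(H)`. -/
theorem isIsomorphicToOperatorAlgebra_of_le {H : Type w} [NormedAddCommGroup H]
    [InnerProductSpace ℂ H] [CompleteSpace H] (π : WeightedL1 ω →L[ℂ] (H →L[ℂ] H))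
    (hπ : ∀ a b, π (a * b) = π a * π b) {M : ℝ} (hM : ∀ a, ‖a‖ ≤ M * ‖π a‖) :
    IsIsomorphicToOperatorAlgebra.{u, w} (WeightedL1 ω) := by
  have hanti : AntilipschitzWith M.toNNReal π :=
    AddMonoidHomClass.antilipschitz_of_bound π fun a =>
      (hM a).trans (mul_le_mul_of_nonneg_right (Real.le_coe_toNNReal M) (norm_nonneg _))
  have hcl : IsClosed (Set.range π) := hanti.isClosed_range π.uniformContinuous
  let B : NonUnitalSubalgebra ℂ (H →L[ℂ] H) :=
    { LinearMap.range (π : WeightedL1 ω →ₗ[ℂ] (H →L[ℂ] H)) with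
      mul_mem' := by
        rintro _ _ ⟨a, rfl⟩ ⟨b, rfl⟩
        exact ⟨a * b, hπ a b⟩ }
  let ψ : WeightedL1 ω ≃L[ℂ] B := π.equivRange hanti.injective hcl
  exact ⟨H, _, _, ‹_›, B, ψ, hcl, fun a b => Subtype.ext (hπ a b)⟩

/-- Bounded operators `T x` on a Hilbert space whose adjoints are antimultiplicative on an invariant
closed subspace `S` give a representation of `ℓ¹(G, ω)` on `S`; enough matrix coefficients with one
vector in `S` make it bounded below. -/
theorem isIsomorphicToOperatorAlgebra_of_compression {K : Type w} [NormedAddCommGroup K]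
    [InnerProductSpace ℂ K] [CompleteSpace K] (T : G → K →L[ℂ] K) {C : ℝ} (hC : 0 ≤ C)
    (hT : ∀ x, ‖T x‖ ≤ C * ω x) (S : Submodule ℂ K) [CompleteSpace S]
    (hS : ∀ x, ∀ s ∈ S, ContinuousLinearMap.adjoint (T x) s ∈ S)
    (hmul : ∀ x y, ∀ s ∈ S, ContinuousLinearMap.adjoint (T (x * y)) s =
      ContinuousLinearMap.adjoint (T y) (ContinuousLinearMap.adjoint (T x) s)) {M : ℝ}
    (hsep : ∀ f : WeightedL1 ω, ∃ ξ η : K, η ∈ S ∧ ‖ξ‖ ≤ M ∧ ‖η‖ ≤ M ∧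
      ∀ x, f x * inner ℂ η (T x ξ) = (‖f x‖ * ω x : ℝ)) :
    IsIsomorphicToOperatorAlgebra.{u, w} (WeightedL1 ω) := by
  obtain ⟨σ, hσ⟩ : ∃ σ : G → S →L[ℂ] S,
      ∀ x s, (σ x s : K) = ContinuousLinearMap.adjoint (T x) s :=
    ⟨fun x => ((ContinuousLinearMap.adjoint (T x)).comp S.subtypeL).codRestrict S
      fun s => hS x s s.2, fun x s => rfl⟩
  have hσmul : ∀ x y, σ (x * y) = (σ y).comp (σ x) := fun x y => by
    ext s
    rw [hσ, ContinuousLinearMap.comp_apply, hσ, hσ]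
    exact hmul x y s s.2
  have hσn : ∀ x, ‖σ x‖ ≤ C * ω x := fun x =>
    (σ x).opNorm_le_bound (mul_nonneg hC (ω.pos x).le) fun s => by
      change ‖(σ x s : K)‖ ≤ _
      rw [hσ]
      refine ((ContinuousLinearMap.adjoint (T x)).le_opNorm s).trans ?_
      rw [LinearIsometryEquiv.norm_map]
      exact mul_le_mul_of_nonneg_right (hT x) (norm_nonneg _)
  have hρn : ∀ x, ‖ContinuousLinearMap.adjoint (σ x)‖ ≤ C * ω x := fun x => by
    rw [LinearIsometryEquiv.norm_map]
    exact hσn x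
  have hρ : ∀ x y, ContinuousLinearMap.adjoint (σ (x * y)) =
      ContinuousLinearMap.adjoint (σ x) * ContinuousLinearMap.adjoint (σ y) := fun x y => by
    rw [hσmul, ContinuousLinearMap.adjoint_comp]
    rfl
  have hcoef : ∀ x ξ (η : S), inner ℂ η (ContinuousLinearMap.adjoint (σ x)
      (S.orthogonalProjectionOnto ξ)) = inner ℂ (η : K) (T x ξ) := fun x ξ η => by
    rw [ContinuousLinearMap.adjoint_inner_right,
      Submodule.inner_orthogonalProjectionOnto_eq_of_mem_left, hσ,
      ContinuousLinearMap.adjoint_inner_left]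
  obtain ⟨ρ, hρ'⟩ : ∃ ρ : G → S →L[ℂ] S, ∀ x, ρ x = ContinuousLinearMap.adjoint (σ x) :=
    ⟨_, fun _ => rfl⟩
  simp only [← hρ'] at hρn hρ hcoef
  refine isIsomorphicToOperatorAlgebra_of_le (WeightedL1.lift ρ C hρn)
    (WeightedL1.lift_mul hρn hρ) (M := M * M) fun f => ?_
  obtain ⟨ξ, η, hηS, hξ, hη, hf⟩ := hsep f
  have hM : 0 ≤ M := (norm_nonneg _).trans hξ
  have hξn : ‖S.orthogonalProjectionOnto ξ‖ ≤ M :=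
    (S.norm_orthogonalProjectionOnto_apply_le _).trans hξ
  obtain ⟨η', rfl⟩ : ∃ η' : S, (η' : K) = η := ⟨⟨η, hηS⟩, rfl⟩
  replace hcoef := fun x => hcoef x ξ η'
  replace hη : ‖η'‖ ≤ M := hη
  generalize S.orthogonalProjectionOnto ξ = ξ' at hξn hcoef
  let χ : WeightedL1 ω →L[ℂ] ℂ :=
    (innerSL ℂ η').comp ((WeightedL1.lift ρ C hρn).flip ξ')
  have hχ : χ f = (‖f‖ : ℝ) := by
    refine (χ.hasSum (WeightedL1.hasSum_delta f)).unique ?_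
    have h1 : ∀ x, χ (f x • WeightedL1.delta ω x) = (‖f x‖ * ω x : ℝ) := fun x => by
      rw [map_smul, ← hf x, ← hcoef x]
      simp only [χ, ContinuousLinearMap.comp_apply, ContinuousLinearMap.flip_apply,
        WeightedL1.lift_delta, innerSL_apply_apply, smul_eq_mul]
    simp only [h1]
    exact Complex.hasSum_ofReal.2 f.summable.hasSum
  calc ‖f‖ = ‖χ f‖ := by rw [hχ]; simp
    _ ≤ ‖η'‖ * ‖WeightedL1.lift ρ C hρn f ξ'‖ := norm_inner_le_norm _ _
    _ ≤ M * (‖WeightedL1.lift ρ C hρn f‖ * M) := by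
        gcongr
        exact ((WeightedL1.lift ρ C hρn f).le_opNorm ξ').trans (by gcongr)
    _ = M * M * ‖WeightedL1.lift ρ C hρn f‖ := by ring

/-- A bounded operator between seminormed spaces extends to any isometric completion. -/
theorem exists_extension_of_dense_isometry {V K E : Type*} [SeminormedAddCommGroup V]
    [NormedSpace ℂ V] [NormedAddCommGroup K] [NormedSpace ℂ K] [NormedAddCommGroup E]
    [NormedSpace ℂ E] [CompleteSpace E] {j : V →L[ℂ] K} (hj : ∀ v, ‖j v‖ = ‖v‖)
    (hd : DenseRange j) (T₀ : V →ₗ[ℂ] E) {C : ℝ} (hC : 0 ≤ C) (hT : ∀ v, ‖T₀ v‖ ≤ C * ‖v‖) :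
    ∃ T : K →L[ℂ] E, ‖T‖ ≤ C ∧ ∀ v, T (j v) = T₀ v := by
  have hT' : ∀ v, ‖T₀ v‖ ≤ C * ‖(j : V →ₗ[ℂ] K) v‖ := fun v => by
    simpa [hj] using hT v
  exact ⟨T₀.extendOfNorm (j : V →ₗ[ℂ] K), LinearMap.opNorm_extendOfNorm_le hd hC hT',
    LinearMap.extendOfNorm_eq hd ⟨C, hT'⟩⟩

/-- A semi-inner product on a space `V`, operators `L x` on it that satisfy `L x * L y = L (x * y)`
modulo an invariant subspace `J`, and enough vectors and functionals killing `J` make `ℓ¹(G, ω)` an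
operator algebra. The Hilbert space is the orthogonal complement of `J` in the completion of `V`,
which is invariant under the adjoints of the operators `L x`. -/
theorem isIsomorphicToOperatorAlgebra_of_quotient {V : Type w} [SeminormedAddCommGroup V]
    [InnerProductSpace ℂ V] (L : G → V →ₗ[ℂ] V) {C : ℝ} (hC : 0 ≤ C)
    (hL : ∀ x v, ‖L x v‖ ≤ C * ω x * ‖v‖) (J : Submodule ℂ V) (hJ : ∀ x, ∀ v ∈ J, L x v ∈ J)
    (hLJ : ∀ x y v, L x (L y v) - L (x * y) v ∈ J) {M : ℝ}
    (hsep : ∀ f : WeightedL1 ω, ∃ (ξ : V) (Λ : V →ₗ[ℂ] ℂ), ‖ξ‖ ≤ M ∧ (∀ v, ‖Λ v‖ ≤ M * ‖v‖) ∧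
      (∀ v ∈ J, Λ v = 0) ∧ ∀ x, f x * Λ (L x ξ) = (‖f x‖ * ω x : ℝ)) :
    IsIsomorphicToOperatorAlgebra.{u, w} (WeightedL1 ω) := by
  obtain ⟨K, _, _, _, j, hj, hd⟩ : ∃ (K : Type w) (_ : NormedAddCommGroup K)
      (_ : InnerProductSpace ℂ K) (_ : CompleteSpace K) (j : V →L[ℂ] K), (∀ v, ‖j v‖ = ‖v‖) ∧
        DenseRange j :=
    ⟨UniformSpace.Completion V, inferInstance, inferInstance, inferInstance,
      UniformSpace.Completion.toComplL, UniformSpace.Completion.norm_coe,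
      UniformSpace.Completion.denseRange_coe⟩
  have hT : ∀ x, ∃ T : K →L[ℂ] K, ‖T‖ ≤ C * ω x ∧ ∀ v, T (j v) = j (L x v) := fun x =>
    exists_extension_of_dense_isometry hj hd ((j : V →ₗ[ℂ] K) ∘ₗ L x)
      (mul_nonneg hC (ω.pos x).le) fun v => (hj _).trans_le (hL x v)
  choose T hTn hTj using hT
  let S : Submodule ℂ K := (J.map (j : V →ₗ[ℂ] K))ᗮ
  have hS : ∀ {s}, s ∈ S ↔ ∀ v ∈ J, inner ℂ (j v) s = 0 := fun {s} => by
    rw [Submodule.mem_orthogonal]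
    exact ⟨fun h v hv => h _ ⟨v, hv, rfl⟩, by rintro h _ ⟨v, hv, rfl⟩; exact h v hv⟩
  refine isIsomorphicToOperatorAlgebra_of_compression T hC hTn S (fun x s hs => hS.2 fun v hv => ?_)
    (fun x y s hs => hd.eq_of_inner_right ℂ fun v => ?_) (M := M) fun f => ?_
  · rw [ContinuousLinearMap.adjoint_inner_right, hTj]
    exact hS.1 hs _ (hJ x v hv)
  · simp only [ContinuousLinearMap.adjoint_inner_right, hTj]
    have := hS.1 hs _ (hLJ x y v)
    rw [map_sub, inner_sub_left, sub_eq_zero] at this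
    exact this.symm
  · obtain ⟨ξ, Λ, hξ, hΛ, hΛJ, hf⟩ := hsep f
    obtain ⟨Λ₁, hΛ₁, hΛj⟩ :=
      exists_extension_of_dense_isometry hj hd Λ ((norm_nonneg _).trans hξ) hΛ
    have hη : ∀ k, inner ℂ ((InnerProductSpace.toDual ℂ K).symm Λ₁) k = Λ₁ k :=
      fun k => InnerProductSpace.toDual_symm_apply
    refine ⟨j ξ, (InnerProductSpace.toDual ℂ K).symm Λ₁, hS.2 fun v hv => ?_,
      (hj ξ).trans_le hξ, ?_, fun x => ?_⟩
    · rw [← inner_conj_symm, hη, hΛj, hΛJ v hv, map_zero]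
    · rwa [LinearIsometryEquiv.norm_map]
    · rw [hη, hTj, hΛj, hf]

end Representation

/-! ### Positive functionals and feature maps -/

section PositiveFunctional

variable {X : Type*} [TopologicalSpace X]

/-- Positivity of a complex functional on `C(X, ℂ)`. -/
def IsPositiveFunctional (P : C(X, ℂ) →ₗ[ℂ] ℂ) : Prop :=
  ∀ f : C(X, ℂ), (∀ k, 0 ≤ (f k).re) → 0 ≤ (P f).re

variable {P : C(X, ℂ) →ₗ[ℂ] ℂ}

theorem IsPositiveFunctional.re_mono (hP : IsPositiveFunctional P) {f g : C(X, ℂ)}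
    (h : ∀ k, (f k).re ≤ (g k).re) : (P f).re ≤ (P g).re := by
  have := hP (g - f) fun k => by simpa using h k
  simpa using this

theorem IsPositiveFunctional.re_eq (hP : IsPositiveFunctional P) {f g : C(X, ℂ)}
    (h : ∀ k, (f k).re = (g k).re) : (P f).re = (P g).re :=
  (hP.re_mono fun k => (h k).le).antisymm (hP.re_mono fun k => (h k).ge)

theorem IsPositiveFunctional.map_star (hP : IsPositiveFunctional P) (f : C(X, ℂ)) :
    P (star f) = starRingEnd ℂ (P f) := by
  have h1 := hP.re_eq (f := star f) (g := f) fun k => by simp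
  have h2 := hP.re_eq (f := Complex.I • star f) (g := Complex.I • -f) fun k => by simp
  apply Complex.ext
  · simpa using h1
  · simpa [neg_eq_iff_eq_neg] using h2

theorem IsPositiveFunctional.smul (hP : IsPositiveFunctional P) {r : ℝ} (hr : 0 ≤ r) :
    IsPositiveFunctional ((r : ℂ) • P) := fun f hf => by
  simpa using mul_nonneg hr (hP f hf)

theorem IsPositiveFunctional.star_mul_self_nonneg (hP : IsPositiveFunctional P) (f : C(X, ℂ)) :
    0 ≤ (P (star f * f)).re :=
  hP _ fun k => by
    simp only [ContinuousMap.mul_apply, ContinuousMap.star_apply, Complex.star_def,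
      ← Complex.normSq_eq_conj_mul_self, Complex.ofReal_re]
    exact Complex.normSq_nonneg _

/-- A Pietsch-type domination theorem: a functional `Λ` bounded by the supremum of the functions
`|T j t|` is dominated by a single positive functional on `C(X)`. -/
theorem exists_isPositiveFunctional_dominating [CompactSpace X] [Nonempty X] {V κ : Type*}
    [AddCommGroup V] [Module ℂ V] (T : κ → V →ₗ[ℂ] C(X, ℂ)) (Λ : V →ₗ[ℂ] ℂ) {M : ℝ}
    (hbdd : ∀ t, ∃ c, ∀ j k, ‖T j t k‖ ≤ c)
    (hΛ : ∀ t c, (∀ j k, ‖T j t k‖ ≤ c) → ‖Λ t‖ ≤ M * c) :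
    ∃ P : C(X, ℂ) →ₗ[ℂ] ℂ, IsPositiveFunctional P ∧ (P 1).re = M ∧
      ∀ t f, (∀ j k, ‖T j t k‖ ≤ (f k).re) → (Λ t).re ≤ (P f).re := by
  obtain ⟨k₀⟩ := ‹Nonempty X›
  let C : PointedCone ℝ (V × C(X, ℂ)) :=
    { carrier := {p | ∀ j k, ‖T j p.1 k‖ ≤ (p.2 k).re}
      zero_mem' := by simp
      add_mem' := fun {p q} hp hq j k => by
        simp only [Prod.fst_add, Prod.snd_add, map_add, ContinuousMap.add_apply, Complex.add_re]
        exact (norm_add_le _ _).trans (add_le_add (hp j k) (hq j k))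
      smul_mem' := fun r p hp j k => by
        have h1 : T j (r • p).1 = ((r : ℝ) : ℂ) • T j p.1 := (T j).map_smul _ _
        have h2 : ((r • p).2 k).re = r * (p.2 k).re := by
          change ((r : ℝ) • p.2 k).re = _
          rw [Complex.smul_re, smul_eq_mul]
        rw [h1, h2, ContinuousMap.smul_apply, norm_smul, Complex.norm_of_nonneg r.2]
        exact mul_le_mul_of_nonneg_left (hp j k) r.2 }
  have hC : ∀ p, p ∈ C ↔ ∀ j k, ‖T j p.1 k‖ ≤ (p.2 k).re := fun p => Iff.rfl
  -- on the constants, the functional to be extended is `(t, r) ↦ M * r - re (Λ t)`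
  let F : V × C(X, ℂ) →ₗ[ℝ] ℝ :=
    { toFun := fun p => M * (p.2 k₀).re - (Λ p.1).re
      map_add' := fun p q => by simp; ring
      map_smul' := fun r p => by
        have h1 : Λ (r • p).1 = (r : ℂ) • Λ p.1 := Λ.map_smul _ _
        have h2 : ((r • p).2 k₀).re = r * (p.2 k₀).re := by
          change ((r : ℝ) • p.2 k₀).re = _
          simp
        rw [h1, h2]
        simp
        ring }
  let D : Submodule ℝ (V × C(X, ℂ)) := Submodule.prod ⊤ (Submodule.span ℝ {1})
  obtain ⟨g, hgD, hgC⟩ := riesz_extension C (F.toPMap D) (by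
      rintro ⟨⟨t, f⟩, _, hf⟩ hp
      obtain ⟨r, rfl⟩ := Submodule.mem_span_singleton.1 hf
      have hr : ∀ k, ((r • (1 : C(X, ℂ))) k).re = r := fun k => by simp
      have := (Complex.re_le_norm _).trans (hΛ t r fun j k => (hp j k).trans_eq (hr k))
      change 0 ≤ M * ((r • (1 : C(X, ℂ))) k₀).re - (Λ t).re
      rw [hr]
      linarith) (by
      rintro ⟨t, f⟩
      obtain ⟨c, hc⟩ := hbdd t
      refine ⟨⟨(0, (c + ‖f‖) • 1), trivial,
        Submodule.smul_mem _ _ (Submodule.mem_span_singleton_self _)⟩, fun j k => ?_⟩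
      have h1 : -‖f‖ ≤ (f k).re := (abs_le.1 ((Complex.abs_re_le_norm _).trans
        (f.norm_coe_le_norm k))).1
      have h2 := hc j k
      simp
      linarith)
  let g₀ : Module.Dual ℝ C(X, ℂ) := g ∘ₗ LinearMap.inr ℝ V C(X, ℂ)
  let P : C(X, ℂ) →ₗ[ℂ] ℂ := g₀.extendRCLike
  have hP : ∀ f, (P f).re = g (0, f) := fun f =>
    Module.Dual.re_extendRCLike_apply (𝕜 := ℂ) g₀ f
  have hD : ∀ t r, g (t, r • 1) = M * r - (Λ t).re := fun t r => by
    have := hgD ⟨(t, r • 1), trivial,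
      Submodule.smul_mem _ _ (Submodule.mem_span_singleton_self _)⟩
    refine this.trans ?_
    change M * ((r • (1 : C(X, ℂ))) k₀).re - (Λ t).re = _
    simp
  refine ⟨P, fun f hf => ?_, ?_, fun t f hf => ?_⟩
  · rw [hP]
    exact hgC _ fun j k => by simpa using hf k
  · rw [hP, ← one_smul ℝ (1 : C(X, ℂ)), hD]
    simp
  · have h1 : 0 ≤ g (t, f) := hgC _ hf
    have h2 : g (t, f) = g (t, (0 : ℝ) • 1) + g (0, f) := by rw [← map_add]; simp
    rw [h2, hD] at h1
    rw [hP]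
    linarith

end PositiveFunctional

section FeatureMap

variable {X Γ V : Type*} [TopologicalSpace X] [AddCommGroup V] [Module ℂ V]
  (Q : Γ → C(X, ℂ) →ₗ[ℂ] ℂ) (T : V →ₗ[ℂ] Γ →₀ C(X, ℂ))

/-- The sesquilinear form `∑ γ, Q γ (conj (T s γ) * T t γ)`. -/
def featureInner (s t : V) : ℂ := (T s).sum fun γ f => Q γ (star f * T t γ)

theorem featureInner_eq_sum {s : V} {S : Finset Γ} (hS : (T s).support ⊆ S) (t : V) :
    featureInner Q T s t = ∑ γ ∈ S, Q γ (star (T s γ) * T t γ) :=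
  Finsupp.sum_of_support_subset _ hS _ fun γ _ => by simp

theorem re_featureInner_smul (c : ℂ) (t : V) :
    (featureInner Q T (c • t) (c • t)).re = ‖c‖ ^ 2 * (featureInner Q T t t).re := by
  rw [featureInner_eq_sum Q T (s := c • t) (S := (T t).support)
    (by rw [map_smul]; exact Finsupp.support_smul), featureInner_eq_sum Q T subset_rfl,
    Complex.re_sum, Complex.re_sum, Finset.mul_sum]
  refine Finset.sum_congr rfl fun γ _ => ?_
  rw [map_smul, Finsupp.smul_apply, star_smul, smul_mul_smul_comm, Complex.star_def,
    ← Complex.normSq_eq_conj_mul_self, Complex.normSq_eq_norm_sq, map_smul, smul_eq_mul,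
    Complex.re_ofReal_mul]

/-- The sesquilinear form of a feature map and positive functionals is a semi-inner product. -/
@[reducible] def featureCore (hQ : ∀ γ, IsPositiveFunctional (Q γ)) :
    PreInnerProductSpace.Core ℂ V where
  inner := featureInner Q T
  conj_inner_symm s t := by
    classical
    rw [featureInner_eq_sum Q T (Finset.subset_union_left (s₂ := (T s).support)),
      featureInner_eq_sum Q T (Finset.subset_union_right (s₁ := (T t).support)), map_sum]
    refine Finset.sum_congr rfl fun γ _ => ?_
    rw [← (hQ γ).map_star, star_mul, star_star]
  re_inner_nonneg s := by
    rw [featureInner_eq_sum Q T subset_rfl, map_sum]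
    exact Finset.sum_nonneg fun γ _ => (hQ γ).star_mul_self_nonneg _
  add_left s s' t := by
    classical
    rw [featureInner_eq_sum Q T (s := s + s')
        (S := (T s).support ∪ (T s').support) (by rw [map_add]; exact Finsupp.support_add),
      featureInner_eq_sum Q T (Finset.subset_union_left (s₂ := (T s').support)),
      featureInner_eq_sum Q T (Finset.subset_union_right (s₁ := (T s).support)),
      ← Finset.sum_add_distrib]
    exact Finset.sum_congr rfl fun γ _ => by simp [add_mul]
  smul_left s t c := by
    rw [featureInner_eq_sum Q T (s := c • s) (S := (T s).support)
        (by rw [map_smul]; exact Finsupp.support_smul),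
      featureInner_eq_sum Q T subset_rfl, Finset.mul_sum]
    refine Finset.sum_congr rfl fun γ _ => ?_
    rw [map_smul, Finsupp.smul_apply, star_smul, smul_mul_assoc]
    exact (Q γ).map_smul _ _

end FeatureMap

/-! ### Words and iterated multiplication -/

section Words

variable {G : Type u} [Group G] {ω : GroupWeight G}

/-- In an injective algebra, sums of products are controlled by the injective norm of the
corresponding tensors. -/
theorem IsInjectiveAlgebra.exists_bound {A : Type*} [NonUnitalNormedRing A] [NormedSpace ℂ A]
    (h : IsInjectiveAlgebra A) :
    ∃ K : ℝ, 0 ≤ K ∧ ∀ {ι : Type*} (s : Finset ι) (a b : ι → A) (B : ℝ),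
      (∀ χ χ' : StrongDual ℂ A, ‖χ‖ ≤ 1 → ‖χ'‖ ≤ 1 → ‖∑ i ∈ s, χ (a i) * χ' (b i)‖ ≤ B) →
        ‖∑ i ∈ s, a i * b i‖ ≤ K * B := by
  obtain ⟨m, hm⟩ := h
  refine ⟨‖m‖, norm_nonneg _, fun s a b B hB => ?_⟩
  let t : AlgInjectiveTensor A A := ∑ i ∈ s, (show AlgInjectiveTensor A A from a i ⊗ₜ[ℂ] b i)
  have ht : m (t : InjectiveTensor A A) = ∑ i ∈ s, a i * b i := by
    have : (t : InjectiveTensor A A) = ∑ i ∈ s, InjectiveTensor.tmul (a i) (b i) :=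
      map_sum (UniformSpace.Completion.toComplL (𝕜 := ℂ) (E := AlgInjectiveTensor A A)) _ s
    rw [this, map_sum]
    exact Finset.sum_congr rfl fun i _ => hm _ _
  rw [← ht]
  refine (m.le_opNorm _).trans (mul_le_mul_of_nonneg_left ?_ (norm_nonneg _))
  rw [UniformSpace.Completion.norm_coe]
  refine ciSup_le fun p => ?_
  refine le_trans (le_of_eq ?_) (hB p.1 p.2 (mem_closedBall_zero_iff.1 p.1.2)
    (mem_closedBall_zero_iff.1 p.2.2))
  exact congrArg _ (map_sum (dualTensor (p.1 : StrongDual ℂ A) (p.2 : StrongDual ℂ A)) _ s)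

/-- Sequences of functionals in the unit ball of the dual of `ℓ¹(G, ω)`, that is, of functions on
`G` dominated by `ω`; this is a compact space. -/
abbrev DualSeq (ω : GroupWeight G) : Type u := ℕ → (x : G) → Metric.closedBall (0 : ℂ) (ω x)

instance DualSeq.instCompactSpace : CompactSpace (DualSeq ω) := by
  have (x : G) : CompactSpace (Metric.closedBall (0 : ℂ) (ω x)) :=
    isCompact_iff_compactSpace.1 (isCompact_closedBall _ _)
  infer_instance

instance DualSeq.instNonempty : Nonempty (DualSeq ω) :=
  ⟨fun _ x => ⟨0, Metric.mem_closedBall_self (ω.pos x).le⟩⟩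

/-- The function `k ↦ kⱼ(x)`. -/
def dualSeqCoord (ω : GroupWeight G) (j : ℕ) (x : G) : C(DualSeq ω, ℂ) :=
  ⟨fun k => (k j x : ℂ), by fun_prop⟩

theorem norm_dualSeqCoord_apply_le (j : ℕ) (x : G) (k : DualSeq ω) :
    ‖dualSeqCoord ω j x k‖ ≤ ω x :=
  mem_closedBall_zero_iff.1 (k j x).2

/-- The elementary tensor `x₁ ⊗ ⋯ ⊗ xₙ` as a function on sequences of functionals. The letters are
numbered from the end of the word, so that the numbers do not change when a letter is prepended. -/
def wordEval (ω : GroupWeight G) : List G → C(DualSeq ω, ℂ)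
  | [] => 1
  | x :: l => dualSeqCoord ω l.length x * wordEval ω l

theorem wordEval_update (l : List G) {n : ℕ} (hn : l.length ≤ n) (k : DualSeq ω)
    (z : (x : G) → Metric.closedBall (0 : ℂ) (ω x)) :
    wordEval ω l (Function.update k n z) = wordEval ω l k := by
  induction l with
  | nil => rfl
  | cons x l ih =>
    have hl : l.length < n := hn
    simp only [wordEval, ContinuousMap.mul_apply, ih hl.le]
    simp [dualSeqCoord, Function.update_of_ne hl.ne]

/-- Multiplication of `n` letters is bounded for the `n`-fold injective norm, with a constant that
grows exponentially. -/
theorem norm_sum_smul_delta_prod_le {K D : ℝ} (hD : 0 ≤ D) (hKD : K ≤ D) (hωD : ω 1 ≤ D)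
    {ι : Type*} (hK : ∀ (s : Finset ι) (a b : ι → WeightedL1 ω) (B : ℝ),
      (∀ χ χ' : StrongDual ℂ (WeightedL1 ω), ‖χ‖ ≤ 1 → ‖χ'‖ ≤ 1 →
        ‖∑ i ∈ s, χ (a i) * χ' (b i)‖ ≤ B) → ‖∑ i ∈ s, a i * b i‖ ≤ K * B)
    (s : Finset ι) {n : ℕ} (w : ι → List G) (hw : ∀ i ∈ s, (w i).length = n) (c : ι → ℂ) {B : ℝ}
    (hB : ∀ k, ‖∑ i ∈ s, c i * wordEval ω (w i) k‖ ≤ B) :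
    ‖∑ i ∈ s, c i • WeightedL1.delta ω (w i).prod‖ ≤ D ^ (n + 1) * B := by
  obtain ⟨k₀⟩ := DualSeq.instNonempty (ω := ω)
  induction n generalizing w c B with
  | zero =>
    have hw' : ∀ i ∈ s, w i = [] := fun i hi => List.eq_nil_of_length_eq_zero (hw i hi)
    have h1 : ∑ i ∈ s, c i • WeightedL1.delta ω (w i).prod =
        (∑ i ∈ s, c i) • WeightedL1.delta ω 1 := by
      rw [Finset.sum_smul]
      exact Finset.sum_congr rfl fun i hi => by simp [hw' i hi]
    have h2 : ‖∑ i ∈ s, c i‖ ≤ B := by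
      refine le_trans (le_of_eq ?_) (hB k₀)
      exact congrArg _ (Finset.sum_congr rfl fun i hi => by simp [hw' i hi, wordEval])
    rw [h1, norm_smul, WeightedL1.norm_delta, zero_add, pow_one, mul_comm]
    exact mul_le_mul hωD h2 (norm_nonneg _) hD
  | succ n ih =>
    have hB0 : 0 ≤ B := (norm_nonneg _).trans (hB k₀)
    have hcons : ∀ i ∈ s, w i = (w i).headD 1 :: (w i).tail := fun i hi => by
      have := hw i hi
      cases h : w i with
      | nil => simp [h] at this
      | cons x l => rfl
    have hlen : ∀ i ∈ s, (w i).tail.length = n := fun i hi => by simp [hw i hi]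
    have h1 : ∑ i ∈ s, c i • WeightedL1.delta ω (w i).prod =
        ∑ i ∈ s, (c i • WeightedL1.delta ω ((w i).headD 1)) *
          WeightedL1.delta ω (w i).tail.prod :=
      Finset.sum_congr rfl fun i hi => by
        rw [smul_mul_assoc, WeightedL1.delta_mul_delta, ← List.prod_cons, ← hcons i hi]
    rw [h1, pow_succ', mul_assoc]
    refine (hK s _ _ (D ^ (n + 1) * B) fun χ χ' hχ hχ' => ?_).trans
      (mul_le_mul_of_nonneg_right hKD (by positivity))
    have h2 : ∑ i ∈ s, χ (c i • WeightedL1.delta ω ((w i).headD 1)) *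
          χ' (WeightedL1.delta ω (w i).tail.prod) =
        χ' (∑ i ∈ s, (c i * χ (WeightedL1.delta ω ((w i).headD 1))) •
          WeightedL1.delta ω (w i).tail.prod) := by
      rw [map_sum]
      exact Finset.sum_congr rfl fun i _ => by rw [map_smul, map_smul]; rfl
    rw [h2]
    refine (χ'.le_of_opNorm_le hχ' _).trans ?_
    rw [one_mul]
    refine ih _ hlen _ fun k => ?_
    -- the functional `χ` is inserted in the coordinate of the first letter
    let z : (x : G) → Metric.closedBall (0 : ℂ) (ω x) := fun x =>
      ⟨χ (WeightedL1.delta ω x), mem_closedBall_zero_iff.2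
        (by simpa using WeightedL1.norm_clm_delta_le χ hχ x)⟩
    refine le_trans (le_of_eq ?_) (hB (Function.update k n z))
    refine congrArg _ (Finset.sum_congr rfl fun i hi => ?_)
    conv_rhs => rw [hcons i hi]
    rw [wordEval, ContinuousMap.mul_apply, wordEval_update _ (hlen i hi).le, hlen i hi]
    simp [dualSeqCoord, z, mul_assoc]

end Words

section SemiInner

variable {G : Type u} [Group G] {ω : GroupWeight G}

/-- The quotient construction for a semi-inner product that is not bundled as an instance; the
bounds are stated for squares. -/
theorem isIsomorphicToOperatorAlgebra_of_core {V : Type w} [AddCommGroup V] [Module ℂ V]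
    (core : PreInnerProductSpace.Core ℂ V) (L : G → V →ₗ[ℂ] V) {C : ℝ} (hC : 0 ≤ C)
    (hL : ∀ x v, (core.inner (L x v) (L x v)).re ≤ (C * ω x) ^ 2 * (core.inner v v).re)
    (J : Submodule ℂ V) (hJ : ∀ x, ∀ v ∈ J, L x v ∈ J)
    (hLJ : ∀ x y v, L x (L y v) - L (x * y) v ∈ J) {M : ℝ}
    (hsep : ∀ f : WeightedL1 ω, ∃ (ξ : V) (Λ : V →ₗ[ℂ] ℂ), (core.inner ξ ξ).re ≤ M ∧
      (∀ v, ‖Λ v‖ ^ 2 ≤ M * (core.inner v v).re) ∧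
      (∀ v ∈ J, Λ v = 0) ∧ ∀ x, f x * Λ (L x ξ) = (‖f x‖ * ω x : ℝ)) :
    IsIsomorphicToOperatorAlgebra.{u, w} (WeightedL1 ω) := by
  let _ : SeminormedAddCommGroup V := InnerProductSpace.Core.toSeminormedAddCommGroup (𝕜 := ℂ)
  let _ : InnerProductSpace ℂ V := InnerProductSpace.ofCore core
  have hn : ∀ v : V, ‖v‖ ^ 2 = (core.inner v v).re := fun v =>
    (inner_self_eq_norm_sq (𝕜 := ℂ) v).symm
  simp only [← hn] at hL hsep
  refine isIsomorphicToOperatorAlgebra_of_quotient L hC (fun x v => ?_) J hJ hLJ (M := √M)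
    fun f => ?_
  · refine (sq_le_sq₀ (norm_nonneg _)
      (mul_nonneg (mul_nonneg hC (ω.pos x).le) (norm_nonneg _))).1 ?_
    rw [mul_pow]
    exact hL x v
  · obtain ⟨ξ, Λ, hξ, hΛ, h⟩ := hsep f
    refine ⟨ξ, Λ, Real.le_sqrt_of_sq_le hξ, fun v => ?_, h⟩
    have hM : 0 ≤ M := (sq_nonneg _).trans hξ
    refine (sq_le_sq₀ (norm_nonneg _) (by positivity)).1 ?_
    rw [mul_pow, Real.sq_sqrt hM]
    exact hΛ v

end SemiInner

/-! ### The space of words -/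

section WordSpace

variable {G : Type u} [Group G] {ω : GroupWeight G}

/-- The functions `φ` on `G` with `|φ| ≤ ω`, lifted to a larger universe. -/
abbrev DominatedFun (ω : GroupWeight G) : Type (max u v) :=
  ULift.{v} {φ : G → ℂ // ∀ x, ‖φ x‖ ≤ ω x}

/-- Formal linear combinations of words in `G`, one copy for each dominated function. -/
abbrev WordSpace (ω : GroupWeight G) : Type (max u v) := DominatedFun.{u, v} ω × List G →₀ ℂ

/-- The functional that a dominated function `φ` induces on its copy of the words. -/
def wordFunctional (φ : DominatedFun.{u, v} ω) : WordSpace.{u, v} ω →ₗ[ℂ] ℂ :=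
  open Classical in
  Finsupp.linearCombination ℂ fun i => if i.1 = φ then φ.down.1 i.2.prod else 0

/-- Prepending a letter to all words. -/
def prepend (ω : GroupWeight G) (x : G) : WordSpace.{u, v} ω →ₗ[ℂ] WordSpace.{u, v} ω :=
  Finsupp.lmapDomain ℂ ℂ fun i => (i.1, x :: i.2)

/-- The linear combinations of words that vanish when the words are multiplied out in `G`. -/
def relations (ω : GroupWeight G) : Submodule ℂ (WordSpace.{u, v} ω) :=
  LinearMap.ker (Finsupp.lmapDomain ℂ ℂ fun i : DominatedFun.{u, v} ω × List G =>
    (i.1, i.2.prod))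

/-- Words are sorted by copy and by length, and each is replaced by its elementary tensor. -/
def wordFeature (ω : GroupWeight G) :
    WordSpace.{u, v} ω →ₗ[ℂ] DominatedFun.{u, v} ω × ℕ →₀ C(DualSeq ω, ℂ) :=
  Finsupp.linearCombination ℂ fun i => Finsupp.single (i.1, i.2.length) (wordEval ω i.2)

theorem mem_relations {t : WordSpace.{u, v} ω} :
    t ∈ relations ω ↔ Finsupp.lmapDomain ℂ ℂ
      (fun i : DominatedFun.{u, v} ω × List G => (i.1, i.2.prod)) t = 0 := Iff.rfl

theorem prepend_mem_relations (x : G) {t : WordSpace.{u, v} ω} (ht : t ∈ relations ω) :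
    prepend ω x t ∈ relations ω := by
  rw [mem_relations] at ht ⊢
  have h := congrArg (Finsupp.mapDomain fun i : DominatedFun.{u, v} ω × G => (i.1, x * i.2)) ht
  simp only [prepend, Finsupp.lmapDomain_apply, ← Finsupp.mapDomain_comp,
    Finsupp.mapDomain_zero] at h ⊢
  exact h

theorem prepend_prepend_sub_mem_relations (x y : G) (t : WordSpace.{u, v} ω) :
    prepend ω x (prepend ω y t) - prepend ω (x * y) t ∈ relations ω := by
  rw [mem_relations, map_sub, sub_eq_zero]
  simp only [prepend, Finsupp.lmapDomain_apply, ← Finsupp.mapDomain_comp]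
  congr 1
  ext i
  · rfl
  · simp [mul_assoc]

theorem wordFunctional_eq_zero (φ : DominatedFun.{u, v} ω) {t : WordSpace.{u, v} ω}
    (ht : t ∈ relations ω) : wordFunctional φ t = 0 := by
  classical
  rw [mem_relations, Finsupp.lmapDomain_apply] at ht
  have h : wordFunctional φ t = Finsupp.linearCombination ℂ
      (fun i : DominatedFun.{u, v} ω × G => if i.1 = φ then φ.down.1 i.2 else 0)
      (Finsupp.mapDomain (fun i => (i.1, i.2.prod)) t) := by
    rw [Finsupp.linearCombination_mapDomain]
    simp only [wordFunctional]
    congr!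
  rw [h, ht, map_zero]

open Classical in
theorem wordFeature_apply (t : WordSpace.{u, v} ω) (γ : DominatedFun.{u, v} ω × ℕ) :
    wordFeature ω t γ =
      ∑ i ∈ t.support with (i.1, i.2.length) = γ, t i • wordEval ω i.2 := by
  rw [wordFeature, Finsupp.linearCombination_apply, Finsupp.sum, Finsupp.finsetSum_apply,
    Finset.sum_filter]
  refine Finset.sum_congr rfl fun i _ => ?_
  rw [Finsupp.smul_apply, Finsupp.single_apply, smul_ite, smul_zero]

theorem wordFeature_prepend_succ (x : G) (t : WordSpace.{u, v} ω) (φ : DominatedFun.{u, v} ω)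
    (j : ℕ) : wordFeature ω (prepend ω x t) (φ, j + 1) =
      dualSeqCoord ω j x * wordFeature ω t (φ, j) := by
  classical
  induction t using Finsupp.induction_linear with
  | zero => simp
  | add s t hs ht => simp only [map_add, Finsupp.add_apply, hs, ht, mul_add]
  | single i a =>
    simp only [prepend, wordFeature, Finsupp.lmapDomain_apply, Finsupp.mapDomain_single,
      Finsupp.linearCombination_single, Finsupp.smul_apply, Finsupp.single_apply, Prod.ext_iff,
      List.length_cons, Nat.add_right_cancel_iff]
    split_ifs with h
    · rw [mul_smul_comm, wordEval, h.2]
    · simp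

theorem wordFeature_prepend_zero (x : G) (t : WordSpace.{u, v} ω) (φ : DominatedFun.{u, v} ω) :
    wordFeature ω (prepend ω x t) (φ, 0) = 0 := by
  classical
  induction t using Finsupp.induction_linear with
  | zero => simp
  | add s t hs ht => simp only [map_add, Finsupp.add_apply, hs, ht, add_zero]
  | single i a => simp [prepend, wordFeature, Prod.ext_iff]

/-- The multilinear estimates for all lengths combine to a bound of a word functional. -/
theorem norm_wordFunctional_le {K D : ℝ} (hD : 0 < D) (hKD : K ≤ D) (hωD : ω 1 ≤ D)
    (hK : ∀ (s : Finset (DominatedFun.{u, v} ω × List G))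
      (a b : DominatedFun.{u, v} ω × List G → WeightedL1 ω) (B : ℝ),
      (∀ χ χ' : StrongDual ℂ (WeightedL1 ω), ‖χ‖ ≤ 1 → ‖χ'‖ ≤ 1 →
        ‖∑ i ∈ s, χ (a i) * χ' (b i)‖ ≤ B) → ‖∑ i ∈ s, a i * b i‖ ≤ K * B)
    (φ : DominatedFun.{u, v} ω) (t : WordSpace.{u, v} ω) {c : ℝ}
    (ht : ∀ j k, ‖((2 * D : ℝ) : ℂ) ^ j * wordFeature ω t (φ, j) k‖ ≤ c) :
    ‖wordFunctional φ t‖ ≤ 2 * D * c := by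
  classical
  obtain ⟨k₀⟩ := DualSeq.instNonempty (ω := ω)
  have hc : 0 ≤ c := (norm_nonneg _).trans (ht 0 k₀)
  let N := t.support.sup (fun i => i.2.length) + 1
  have hN : ∀ i ∈ t.support.filter (fun i => i.1 = φ), i.2.length ∈ Finset.range N := fun i hi =>
    Finset.mem_range.2 (Nat.lt_succ_of_le
      (Finset.le_sup (f := fun i => i.2.length) (Finset.mem_filter.1 hi).1))
  have hφ : ∀ x, ‖φ.down.1 x‖ ≤ 1 * ω x := fun x => by simpa using φ.down.2 x
  let Φ : WeightedL1 ω →L[ℂ] ℂ := WeightedL1.lift φ.down.1 1 hφ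
  have h1 : wordFunctional φ t = ∑ j ∈ Finset.range N,
      Φ (∑ i ∈ t.support with i.1 = φ ∧ i.2.length = j, t i • WeightedL1.delta ω i.2.prod) := by
    rw [wordFunctional, Finsupp.linearCombination_apply, Finsupp.sum]
    simp only [smul_ite, smul_zero]
    rw [← Finset.sum_filter, ← Finset.sum_fiberwise_of_maps_to hN]
    refine Finset.sum_congr rfl fun j _ => ?_
    rw [Finset.filter_filter, map_sum]
    exact Finset.sum_congr rfl fun i _ => by simp [Φ]
  have h2 : ∀ j, ‖Φ (∑ i ∈ t.support with i.1 = φ ∧ i.2.length = j,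
      t i • WeightedL1.delta ω i.2.prod)‖ ≤ D * c * (1 / 2) ^ j := fun j => by
    refine (Φ.le_of_opNorm_le (WeightedL1.norm_lift_le hφ zero_le_one) _).trans ?_
    rw [one_mul]
    refine (norm_sum_smul_delta_prod_le hD.le hKD hωD hK _ (n := j) (fun i => i.2)
      (fun i hi => (Finset.mem_filter.1 hi).2.2) (fun i => t i) (B := c / (2 * D) ^ j)
      fun k => ?_).trans_eq ?_
    · rw [le_div_iff₀ (by positivity)]
      refine le_trans (le_of_eq ?_) (ht j k)
      rw [norm_mul, norm_pow, Complex.norm_of_nonneg (by positivity), mul_comm, wordFeature_apply,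
        ContinuousMap.sum_apply]
      simp [Prod.ext_iff]
    · rw [mul_pow, one_div, inv_pow, pow_succ]
      field_simp
  calc ‖wordFunctional φ t‖ ≤ ∑ j ∈ Finset.range N, D * c * (1 / 2) ^ j := by
        rw [h1]
        exact norm_sum_le_of_le _ fun j _ => h2 j
    _ = D * c * ∑ j ∈ Finset.range N, (1 / 2) ^ j := by rw [Finset.mul_sum]
    _ ≤ D * c * 2 := mul_le_mul_of_nonneg_left (sum_geometric_two_le N) (by positivity)
    _ = 2 * D * c := by ring

end WordSpace

/-! ### The semi-inner product on words -/

section InjectiveAlgebra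

variable {G : Type u} [Group G] {ω : GroupWeight G}

theorem sq_le_mul_of_forall_mul_le {a b M : ℝ} (h : ∀ r, 0 < r → r * a ≤ (M + r ^ 2 * b) / 2)
    (ha : 0 ≤ a) (hb : 0 ≤ b) (hM : 0 ≤ M) : a ^ 2 ≤ M * b := by
  have h' : ∀ r : ℝ, 0 ≤ b * (r * r) + (-2 * a) * r + M := fun r => by
    rcases lt_or_ge 0 r with hr | hr
    · linarith [h r hr, pow_two r ▸ h r hr]
    · nlinarith [mul_nonneg ha (neg_nonneg.2 hr), mul_nonneg hb (mul_self_nonneg r)]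
  have := discrim_le_zero h'
  rw [discrim] at this
  linarith

/-- The weighted positive functionals that define the semi-inner product on words. -/
def weightedFunctional (β : ℝ) (P : DominatedFun.{u, v} ω → C(DualSeq ω, ℂ) →ₗ[ℂ] ℂ)
    (γ : DominatedFun.{u, v} ω × ℕ) : C(DualSeq ω, ℂ) →ₗ[ℂ] ℂ :=
  ((β ^ (2 * γ.2) : ℝ) : ℂ) • P γ.1

variable {β : ℝ} {P : DominatedFun.{u, v} ω → C(DualSeq ω, ℂ) →ₗ[ℂ] ℂ}

theorem re_weightedFunctional (γ : DominatedFun.{u, v} ω × ℕ) (f : C(DualSeq ω, ℂ)) :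
    (weightedFunctional β P γ f).re = β ^ (2 * γ.2) * (P γ.1 f).re := by
  rw [weightedFunctional, LinearMap.smul_apply, smul_eq_mul, Complex.re_ofReal_mul]

theorem isPositiveFunctional_weightedFunctional (hP : ∀ φ, IsPositiveFunctional (P φ))
    (γ : DominatedFun.{u, v} ω × ℕ) : IsPositiveFunctional (weightedFunctional β P γ) :=
  (hP γ.1).smul (by rw [pow_mul]; positivity)

theorem re_star_mul_self (f : C(DualSeq ω, ℂ)) (k : DualSeq ω) :
    ((star f * f) k).re = ‖f k‖ ^ 2 := by
  simp only [ContinuousMap.mul_apply, ContinuousMap.star_apply, Complex.star_def,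
    ← Complex.normSq_eq_conj_mul_self, Complex.ofReal_re, Complex.normSq_eq_norm_sq]

/-- Prepending the letter `x` has norm at most `β * ω x`. -/
theorem re_featureInner_prepend_le (hP : ∀ φ, IsPositiveFunctional (P φ)) (x : G)
    (t : WordSpace.{u, v} ω) :
    (featureInner (weightedFunctional β P) (wordFeature ω) (prepend ω x t) (prepend ω x t)).re ≤
      (β * ω x) ^ 2 * (featureInner (weightedFunctional β P) (wordFeature ω) t t).re := by
  classical
  let S := (wordFeature ω t).support
  let e : DominatedFun.{u, v} ω × ℕ → DominatedFun.{u, v} ω × ℕ := fun γ => (γ.1, γ.2 + 1)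
  have hsub : (wordFeature ω (prepend ω x t)).support ⊆ S.image e := by
    rintro ⟨φ, j⟩ h
    rw [Finsupp.mem_support_iff] at h
    cases j with
    | zero => exact absurd (wordFeature_prepend_zero x t φ) h
    | succ j =>
      refine Finset.mem_image.2 ⟨(φ, j), Finsupp.mem_support_iff.2 fun h0 => h ?_, rfl⟩
      rw [wordFeature_prepend_succ, h0, mul_zero]
  have hinj : Function.Injective e := fun γ γ' h => by
    simpa [e, Prod.ext_iff] using h
  rw [featureInner_eq_sum _ _ hsub, featureInner_eq_sum _ _ subset_rfl,
    Finset.sum_image hinj.injOn, Complex.re_sum, Complex.re_sum, Finset.mul_sum]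
  refine Finset.sum_le_sum fun γ _ => ?_
  rw [re_weightedFunctional, re_weightedFunctional, wordFeature_prepend_succ]
  have h1 : (P γ.1 (star (dualSeqCoord ω γ.2 x * wordFeature ω t (γ.1, γ.2)) *
      (dualSeqCoord ω γ.2 x * wordFeature ω t (γ.1, γ.2)))).re ≤
      ω x ^ 2 * (P γ.1 (star (wordFeature ω t γ) * wordFeature ω t γ)).re := by
    rw [← Complex.re_ofReal_mul, ← smul_eq_mul (_ : ℂ) (P γ.1 _), ← map_smul]
    refine (hP γ.1).re_mono fun k => ?_
    rw [re_star_mul_self, ContinuousMap.smul_apply, smul_eq_mul, Complex.re_ofReal_mul,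
      re_star_mul_self, ContinuousMap.mul_apply, norm_mul, mul_pow]
    have := norm_dualSeqCoord_apply_le γ.2 x k
    gcongr
  calc β ^ (2 * (γ.2 + 1)) * _ ≤ β ^ (2 * (γ.2 + 1)) * (ω x ^ 2 *
        (P γ.1 (star (wordFeature ω t γ) * wordFeature ω t γ)).re) :=
        mul_le_mul_of_nonneg_left h1 (by rw [pow_mul]; positivity)
    _ = _ := by ring

/-- Domination of a word functional by its positive functional turns into boundedness for the
semi-inner product, by the inequality `|z| ≤ (1 + |z|²) / 2`. -/
theorem re_wordFunctional_le (hβ : 0 ≤ β) (hP : ∀ φ, IsPositiveFunctional (P φ)) {M : ℝ}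
    (hPM : ∀ φ, (P φ 1).re = M) {φ : DominatedFun.{u, v} ω}
    (hdom : ∀ (t : WordSpace.{u, v} ω) (f : C(DualSeq ω, ℂ)),
      (∀ j k, ‖(β : ℂ) ^ j * wordFeature ω t (φ, j) k‖ ≤ (f k).re) →
        (wordFunctional φ t).re ≤ (P φ f).re) (t : WordSpace.{u, v} ω) :
    (wordFunctional φ t).re ≤
      (M + (featureInner (weightedFunctional β P) (wordFeature ω) t t).re) / 2 := by
  classical
  let S := (wordFeature ω t).support
  let f₁ : C(DualSeq ω, ℂ) := ∑ γ ∈ S with γ.1 = φ,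
    ((β ^ (2 * γ.2) : ℝ) : ℂ) • (star (wordFeature ω t γ) * wordFeature ω t γ)
  have hf₁ : ∀ k, (f₁ k).re = ∑ γ ∈ S with γ.1 = φ, (β ^ γ.2 * ‖wordFeature ω t γ k‖) ^ 2 :=
    fun k => by
      rw [ContinuousMap.sum_apply, Complex.re_sum]
      refine Finset.sum_congr rfl fun γ _ => ?_
      rw [ContinuousMap.smul_apply, smul_eq_mul, Complex.re_ofReal_mul, re_star_mul_self]
      ring
  have h1 : (wordFunctional φ t).re ≤ (P φ (((1 / 2 : ℝ) : ℂ) • (1 + f₁))).re := by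
    refine hdom t _ fun j k => ?_
    have h2 : (β ^ j * ‖wordFeature ω t (φ, j) k‖) ^ 2 ≤ (f₁ k).re := by
      rw [hf₁]
      by_cases hj : (φ, j) ∈ S
      · exact Finset.single_le_sum
          (f := fun γ : DominatedFun.{u, v} ω × ℕ => (β ^ γ.2 * ‖wordFeature ω t γ k‖) ^ 2)
          (fun _ _ => sq_nonneg _) ((Finset.mem_filter (p := fun γ => γ.1 = φ)).2 ⟨hj, rfl⟩)
      · rw [Finsupp.notMem_support_iff.1 hj]
        simpa using Finset.sum_nonneg fun _ _ => sq_nonneg _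
    rw [norm_mul, norm_pow, Complex.norm_of_nonneg hβ, ContinuousMap.smul_apply, smul_eq_mul,
      Complex.re_ofReal_mul, ContinuousMap.add_apply, Complex.add_re, ContinuousMap.one_apply,
      Complex.one_re]
    nlinarith [sq_nonneg (β ^ j * ‖wordFeature ω t (φ, j) k‖ - 1)]
  have h3 : (P φ f₁).re ≤ (featureInner (weightedFunctional β P) (wordFeature ω) t t).re := by
    rw [featureInner_eq_sum _ _ subset_rfl, map_sum, Complex.re_sum, Complex.re_sum]
    calc _ = ∑ γ ∈ S with γ.1 = φ,
          (weightedFunctional β P γ (star (wordFeature ω t γ) * wordFeature ω t γ)).re :=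
          Finset.sum_congr rfl fun γ hγ => by
            rw [weightedFunctional, (Finset.mem_filter.1 hγ).2, map_smul, LinearMap.smul_apply]
      _ ≤ _ := Finset.sum_le_sum_of_subset_of_nonneg (Finset.filter_subset _ _) fun γ _ _ =>
          (isPositiveFunctional_weightedFunctional hP γ).star_mul_self_nonneg _
  rw [map_smul, smul_eq_mul, Complex.re_ofReal_mul, map_add, Complex.add_re, hPM] at h1
  linarith

theorem isIsomorphicToOperatorAlgebra_of_isInjectiveAlgebra
    (h : IsInjectiveAlgebra (WeightedL1 ω)) :
    IsIsomorphicToOperatorAlgebra.{u, max u v} (WeightedL1 ω) := by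
  classical
  obtain ⟨K, -, hK⟩ := h.exists_bound
  let D := max K (max (ω 1) 1)
  have hD : 0 < D := one_pos.trans_le ((le_max_right _ _).trans (le_max_right _ _))
  have hβ : 0 ≤ 2 * D := by positivity
  have hpos : ∀ φ : DominatedFun.{u, v} ω, ∃ P : C(DualSeq ω, ℂ) →ₗ[ℂ] ℂ,
      IsPositiveFunctional P ∧ (P 1).re = 2 * D ∧
        ∀ (t : WordSpace.{u, v} ω) (f : C(DualSeq ω, ℂ)),
          (∀ j k, ‖((2 * D : ℝ) : ℂ) ^ j * wordFeature ω t (φ, j) k‖ ≤ (f k).re) →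
            (wordFunctional φ t).re ≤ (P f).re := fun φ => by
    refine exists_isPositiveFunctional_dominating
      (fun j : ℕ => ((2 * D : ℝ) : ℂ) ^ j • (Finsupp.lapply (φ, j) ∘ₗ wordFeature ω))
      (wordFunctional φ) (fun t => ?_) fun t c ht =>
        norm_wordFunctional_le hD (le_max_left _ _)
          ((le_max_left _ _).trans (le_max_right _ _)) (fun s a b B => hK s a b B) φ t ht
    refine ⟨∑ γ ∈ (wordFeature ω t).support, (2 * D) ^ γ.2 * ‖wordFeature ω t γ‖, fun j k => ?_⟩
    change ‖((2 * D : ℝ) : ℂ) ^ j * wordFeature ω t (φ, j) k‖ ≤ _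
    rw [norm_mul, norm_pow, Complex.norm_of_nonneg hβ]
    by_cases hj : (φ, j) ∈ (wordFeature ω t).support
    · refine le_trans ?_ (Finset.single_le_sum
        (f := fun γ : DominatedFun.{u, v} ω × ℕ => (2 * D) ^ γ.2 * ‖wordFeature ω t γ‖)
        (fun _ _ => by positivity) hj)
      exact mul_le_mul_of_nonneg_left (ContinuousMap.norm_coe_le_norm _ _) (by positivity)
    · rw [Finsupp.notMem_support_iff.1 hj]
      simpa using Finset.sum_nonneg fun _ _ => by positivity
  choose P hP hP1 hdom using hpos
  have hQ := isPositiveFunctional_weightedFunctional (β := 2 * D) hP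
  refine isIsomorphicToOperatorAlgebra_of_core
    (featureCore (weightedFunctional (2 * D) P) (wordFeature ω) hQ) (prepend ω) hβ
    (re_featureInner_prepend_le hP) (relations ω) (fun x t => prepend_mem_relations x)
    prepend_prepend_sub_mem_relations (M := 2 * D) fun f => ?_
  -- a dominated function that norms `f`
  have hφ : ∀ x, ‖(ω x : ℂ) * (starRingEnd ℂ (f x) / ‖f x‖)‖ ≤ ω x := fun x => by
    rw [norm_mul, Complex.norm_of_nonneg (ω.pos x).le, norm_div, RCLike.norm_conj,
      Complex.norm_real, norm_norm]
    exact mul_le_of_le_one_right (ω.pos x).le (div_self_le_one _)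
  let φ : DominatedFun.{u, v} ω := ⟨⟨_, hφ⟩⟩
  refine ⟨Finsupp.single (φ, []) 1, wordFunctional φ, ?_, fun t => ?_,
    fun t => wordFunctional_eq_zero φ, fun x => ?_⟩
  · have hT : wordFeature ω (Finsupp.single (φ, []) 1) = Finsupp.single (φ, 0) 1 := by
      simp [wordFeature, wordEval]
    change (featureInner _ _ _ _).re ≤ _
    rw [featureInner, hT, Finsupp.sum_single_index (by simp), re_weightedFunctional]
    simp [hP1]
  · change _ ≤ _ * (featureInner _ _ _ _).re
    have hnn : 0 ≤ (featureInner (weightedFunctional (2 * D) P) (wordFeature ω) t t).re :=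
      (featureCore _ (wordFeature ω) hQ).re_inner_nonneg t
    refine sq_le_mul_of_forall_mul_le (fun r hr => ?_) (norm_nonneg _) hnn hβ
    -- rotate `t` so that the functional takes the value `r * |Λ t|`
    obtain ⟨z, hz, hzt⟩ := RCLike.exists_norm_eq_mul_self (wordFunctional φ t)
    have := re_wordFunctional_le hβ hP hP1 (hdom φ) (((r : ℂ) * z) • t)
    rw [re_featureInner_smul, map_smul, smul_eq_mul, mul_assoc, ← hzt, norm_mul, hz,
      mul_one, Complex.norm_of_nonneg hr.le, Complex.re_ofReal_mul] at this
    exact this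
  · have : wordFunctional φ (prepend ω x (Finsupp.single (φ, []) 1)) =
        ω x * (starRingEnd ℂ (f x) / ‖f x‖) := by
      simp [wordFunctional, prepend, φ]
    rw [this]
    by_cases h0 : f x = 0
    · simp [h0]
    · have h1 : (‖f x‖ : ℂ) ≠ 0 := by simpa using h0
      rw [mul_left_comm, ← mul_div_assoc, Complex.mul_conj, Complex.normSq_eq_norm_sq]
      push_cast
      field_simp

end InjectiveAlgebra

end

theorem mainTheorem4 {G : Type u} [Group G] (ω : GroupWeight G) :
    IsInjectiveAlgebra (WeightedL1 ω) ↔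
      IsIsomorphicToOperatorAlgebra.{u, max u v} (WeightedL1 ω) :=
  ⟨isIsomorphicToOperatorAlgebra_of_isInjectiveAlgebra.{u, v},
    isInjectiveAlgebra_of_isIsomorphicToOperatorAlgebra⟩
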